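/- **Setting.** Let $A=(a_{ij})_{1\le i,j\le n}$ be a generalized Cartan matrix ($a_{ii}=2$; $a_{ij}\in\mathbb Z_{\le 0}$ for $i\ne j$; $a_{ij}=0\Leftrightarrow a_{ji}=0$). Let $\mathfrak h$ be a complex vector space of dimension $2n-\operatorname{rank}A$ with linearly independent simple roots $\alpha_1,\dots,\alpha_n\in\mathfrak h^*$ and linearly independent simple coroots $\alpha_1^\vee,\dots,\alpha_n^\vee\in\mathfrak h$ such that $a_{ij}=\langle\alpha_j,\alpha_i^\vee\rangle$. Let $W\subset GL(\mathfrak h^*)$ be the Weyl group, generated by the reflections $s_i(\lambda)=\lambda-\langle\lambda,\alpha_i^\vee\rangle\alpha_i$, with length function $\ell$ (the least number of factors $s_i$ needed). Let $\Phi=\{w(\alpha_i)\}$ be the set of real roots and $\Phi_+=\Phi\cap\sum_i\mathbb Z_{\ge0}\,\alpha_i$ the set of positive real roots. Let $\Lambda\subset\mathfrak h^*$ be a Demazure lattice, i.e. a finitely generated subgroup such that $\langle\Lambda,\alpha_i^\vee\rangle\subset\mathbb Z$ for all $i$ and such that every simple root lies in $\Lambda$ and can be extended to a $\mathbb Z$-basis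 of $\Lambda$. Let $R$ be an integral domain of characteristic $0$ and $F$ a one-dimensional commutative formal group law over $R$. Let $S=R[[\Lambda]]_F=R[[x_\lambda\mid\lambda\in\Lambda]]/J$ be the formal group algebra, where $R[[x_\lambda\mid\lambda\in\Lambda]]$ is the completion of the polynomial ring $R[x_\lambda\mid\lambda\in\Lambda]$ at the ideal generated by the variables and $J$ is the closure of the ideal generated by $x_0$ and all $x_{\lambda+\mu}-F(x_\lambda,x_\mu)$. The group $W$ acts on $S$ by $w(x_\lambda)=x_{w(\lambda)}$. Let $Q=S[\tfrac1{x_\beta}\mid\beta\in\Phi]$ (inverting only the $x_\beta$ with $\beta\in\Phi_+$ gives the same ring, since $\Phi=\Phi_+\amalg-\Phi_+$ and $x_{-\beta}$ is a unit multiple of $x_\beta$ in $S$). Let $Q_W$ be the twisted group algebra: the free left $Q$-module with basis $\{\delta_w\}_{w\in W}$ and product $q\delta_w\cdot q'\delta_{w'}=q\,w(q')\,\delta_{ww'}$. It acts on $Q$ by $(q\delta_w)\cdot q'=q\,w(q')$. Put $X_i=\frac1{x_{\alpha_i}}(1-\delta_{s_i})\in Q_W$. For each $w\in W$ fix a reduced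 sequence $I_w=(i_1,\dots,i_l)$, i.e. $w=s_{i_1}\cdots s_{i_l}$ with $l=\ell(w)$, and put $X_{I_w}=X_{i_1}\cdots X_{i_l}$ (with $X_\emptyset=1$). **Proposition 3.3.** Let $k\ge 0$, let $z=\sum_{w\in W,\ \ell(w)\le k}p_wX_{I_w}\in Q_W$ with $p_w\in S$, and let $\alpha\in\Phi_+$. If $z\cdot S\subseteq x_\alpha S$, then $x_\alpha$ divides $p_w$ in $S$ for every $w\in W$ with $\ell(w)\le k$. -/

import Mathlib

noncomputable section

/-! ## Formal group algebras -/

/-- The power series ring `R⟦x_m | m ∈ M⟧`: the completion of the polynomial ring `R[x_m | m ∈ M]`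
with respect to the kernel of the augmentation `x_m ↦ 0`. When `M` is infinite, the homogeneous
components of its elements are polynomials, each involving finitely many variables only. -/
abbrev CompletedPoly (R M : Type*) [CommRing R] : Type _ :=
  AdicCompletion (MvPolynomial.idealOfVars M R) (MvPolynomial M R)

namespace CompletedPoly

variable (R : Type*) [CommRing R] {M N P : Type*}

/-- The variable `x_m`. -/
def X (m : M) : CompletedPoly R M :=
  AdicCompletion.of (MvPolynomial.idealOfVars M R) (MvPolynomial M R) (MvPolynomial.X m)

/-- The projection of the power series ring to the polynomials modulo terms of degree `≥ d`. -/
abbrev trunc (M : Type*) (d : ℕ) :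
    CompletedPoly R M →+* MvPolynomial M R ⧸ MvPolynomial.idealOfVars M R ^ d :=
  (AdicCompletion.evalₐ (MvPolynomial.idealOfVars M R) d).toRingHom

theorem idealOfVars_pow_le_comap (f : M → N) (d : ℕ) :
    MvPolynomial.idealOfVars M R ^ d ≤
      (MvPolynomial.idealOfVars N R ^ d).comap (MvPolynomial.rename (R := R) f).toRingHom := by
  rw [← Ideal.map_le_iff_le_comap, Ideal.map_pow]
  apply Ideal.pow_right_mono
  rw [Ideal.map_span, Ideal.span_le]
  rintro _ ⟨_, ⟨m, rfl⟩, rfl⟩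
  refine Ideal.subset_span ⟨f m, ?_⟩
  simp

/-- The renaming of variables `x_m ↦ x_{f m}`, modulo degree `d`. -/
def renameQuot (f : M → N) (d : ℕ) :
    MvPolynomial M R ⧸ MvPolynomial.idealOfVars M R ^ d →+*
      MvPolynomial N R ⧸ MvPolynomial.idealOfVars N R ^ d :=
  Ideal.quotientMap _ (MvPolynomial.rename (R := R) f).toRingHom (idealOfVars_pow_le_comap R f d)

theorem renameQuot_compat (f : M → N) {d e : ℕ} (hde : d ≤ e) :
    (Ideal.Quotient.factorPow (MvPolynomial.idealOfVars N R) hde).comp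
      ((renameQuot R f e).comp (trunc R M e)) = (renameQuot R f d).comp (trunc R M d) := by
  ext x
  induction x using AdicCompletion.induction_on with
  | _ x =>
    simp only [trunc, renameQuot, RingHom.comp_apply, AlgHom.toRingHom_eq_coe,
      RingHom.coe_coe, AdicCompletion.evalₐ_mk, Ideal.quotientMap_mk]
    have h := AdicCompletion.Ideal.mk_eq_mk (I := MvPolynomial.idealOfVars M R) hde x
    rw [Ideal.Quotient.eq] at h
    have h' := idealOfVars_pow_le_comap R f d h
    rw [Ideal.mem_comap, map_sub] at h'
    erw [Ideal.Quotient.factor_mk]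
    exact (Ideal.Quotient.eq).2 h'

/-- The continuous substitution `x_m ↦ x_{f m}` on power series. -/
def rename (f : M → N) : CompletedPoly R M →+* CompletedPoly R N :=
  AdicCompletion.liftRingHom (MvPolynomial.idealOfVars N R)
    (fun d => (renameQuot R f d).comp (trunc R M d)) (renameQuot_compat R f)

theorem trunc_rename (f : M → N) (d : ℕ) (x : CompletedPoly R M) :
    trunc R N d (rename R f x) = renameQuot R f d (trunc R M d x) :=
  AdicCompletion.evalₐ_liftRingHom _ _ (renameQuot_compat R f) _ _

theorem ext_trunc {x y : CompletedPoly R M} (h : ∀ d, trunc R M d x = trunc R M d y) : x = y :=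
  AdicCompletion.ext_evalₐ (I := MvPolynomial.idealOfVars M R) h

theorem renameQuot_id (d : ℕ) (x) : renameQuot R (id : M → M) d x = x := by
  obtain ⟨x, rfl⟩ := Ideal.Quotient.mk_surjective x
  simp [renameQuot]

theorem renameQuot_comp (g : N → P) (f : M → N) (d : ℕ) (x) :
    renameQuot R (g ∘ f) d x = renameQuot R g d (renameQuot R f d x) := by
  obtain ⟨x, rfl⟩ := Ideal.Quotient.mk_surjective x
  simp [renameQuot, MvPolynomial.rename_rename]

theorem rename_id (x : CompletedPoly R M) : rename R (id : M → M) x = x :=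
  ext_trunc R fun d => by rw [trunc_rename, renameQuot_id]

theorem rename_comp (g : N → P) (f : M → N) (x : CompletedPoly R M) :
    rename R (g ∘ f) x = rename R g (rename R f x) :=
  ext_trunc R fun d => by simp only [trunc_rename, renameQuot_comp]

theorem rename_X (f : M → N) (m : M) : rename R f (X R m) = X R (f m) :=
  ext_trunc R fun d => by
    rw [trunc_rename]
    simp [trunc, X, renameQuot]

variable {R}

/-- The value `F(x_a, x_b)` of a power series `F` in two variables: `F` is viewed in the completion
of the polynomial ring in two variables, which are then renamed to `x_a`, `x_b`. -/
def eval₂ (F : MvPowerSeries (Fin 2) R) (a b : M) : CompletedPoly R M :=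
  rename R ![a, b] (MvPowerSeries.toAdicCompletion (Fin 2) R F)

theorem rename_eval₂ (F : MvPowerSeries (Fin 2) R) (f : M → N) (a b : M) :
    rename R f (eval₂ F a b) = eval₂ F (f a) (f b) := by
  rw [eval₂, eval₂, ← rename_comp]
  congr 2
  ext i
  fin_cases i <;> rfl

/-- The closure of an ideal of the power series ring: the series that agree with elements of the
ideal up to terms of arbitrarily high degree. -/
def closure (J : Ideal (CompletedPoly R M)) : Ideal (CompletedPoly R M) :=
  ⨅ d : ℕ, J ⊔ RingHom.ker (trunc R M d)

theorem closure_le_comap (f : M → N) {J : Ideal (CompletedPoly R M)}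
    {J' : Ideal (CompletedPoly R N)} (h : J ≤ J'.comap (rename R f)) :
    closure J ≤ (closure J').comap (rename R f) := by
  rw [closure, closure, Ideal.comap_iInf]
  refine iInf_mono fun d => sup_le (h.trans (Ideal.comap_mono le_sup_left)) ?_
  intro x hx
  refine Ideal.mem_sup_right ?_
  rw [RingHom.mem_ker] at hx ⊢
  rw [trunc_rename, hx, map_zero]

end CompletedPoly

namespace FormalGroup

variable {R : Type*} [CommRing R] (F : FormalGroup R)

/-- The closure of the ideal generated by `x_0` and all `x_{l+m} - F(x_l, x_m)`. -/
def relIdeal (M : Type*) [AddCommGroup M] : Ideal (CompletedPoly R M) :=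
  CompletedPoly.closure (Ideal.span ({CompletedPoly.X R 0} ∪
    {y | ∃ l m : M, y = CompletedPoly.X R (l + m) - CompletedPoly.eval₂ F.toPowerSeries l m}))

/-- The formal group algebra `R⟦M⟧_F = R⟦x_m | m ∈ M⟧ / J`. -/
def FGAlgebra (M : Type*) [AddCommGroup M] : Type _ := CompletedPoly R M ⧸ F.relIdeal M

instance (M : Type*) [AddCommGroup M] : CommRing (F.FGAlgebra M) :=
  inferInstanceAs (CommRing (CompletedPoly R M ⧸ F.relIdeal M))

/-- The projection of the power series ring to the formal group algebra. -/
def proj (M : Type*) [AddCommGroup M] : CompletedPoly R M →+* F.FGAlgebra M :=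
  Ideal.Quotient.mk (F.relIdeal M)

theorem proj_surjective (M : Type*) [AddCommGroup M] : Function.Surjective (F.proj M) :=
  Ideal.Quotient.mk_surjective

/-- The element `x_m` of the formal group algebra. -/
def x {M : Type*} [AddCommGroup M] (m : M) : F.FGAlgebra M :=
  F.proj M (CompletedPoly.X R m)

theorem relIdeal_le_comap {M N : Type*} [AddCommGroup M] [AddCommGroup N] (f : M →+ N) :
    F.relIdeal M ≤ (F.relIdeal N).comap (CompletedPoly.rename R f) := by
  refine CompletedPoly.closure_le_comap f (Ideal.span_le.2 ?_)
  rintro y (rfl | ⟨l, m, rfl⟩)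
  · refine Ideal.subset_span (Or.inl ?_)
    rw [CompletedPoly.rename_X, map_zero]
    rfl
  · refine Ideal.subset_span (Or.inr ⟨f l, f m, ?_⟩)
    rw [map_sub, CompletedPoly.rename_X, CompletedPoly.rename_eval₂, map_add]

/-- Functoriality of the formal group algebra: the ring map with `x_m ↦ x_{f m}`. -/
def mapHom {M N : Type*} [AddCommGroup M] [AddCommGroup N] (f : M →+ N) :
    F.FGAlgebra M →+* F.FGAlgebra N :=
  Ideal.quotientMap _ (CompletedPoly.rename R f) (F.relIdeal_le_comap f)

theorem mapHom_proj {M N : Type*} [AddCommGroup M] [AddCommGroup N] (f : M →+ N)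
    (y : CompletedPoly R M) :
    F.mapHom f (F.proj M y) = F.proj N (CompletedPoly.rename R f y) :=
  Ideal.quotientMap_mk

theorem mapHom_x {M N : Type*} [AddCommGroup M] [AddCommGroup N] (f : M →+ N) (m : M) :
    F.mapHom f (F.x m) = F.x (f m) := by
  rw [x, mapHom_proj, CompletedPoly.rename_X, x]

/-- A group acting on `M` acts on the formal group algebra by `w • x_m = x_{w m}`. -/
@[reducible]
def action (G M : Type*) [Group G] [AddCommGroup M] [DistribMulAction G M] :
    MulSemiringAction G (F.FGAlgebra M) :=
  MulSemiringAction.compHom (M := F.FGAlgebra M →+* F.FGAlgebra M) (F.FGAlgebra M)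
    { toFun := fun g => F.mapHom (DistribSMul.toAddMonoidHom M g)
      map_one' := by
        refine RingHom.ext fun y => ?_
        obtain ⟨y, rfl⟩ := F.proj_surjective M y
        rw [mapHom_proj]
        have : ⇑(DistribSMul.toAddMonoidHom M (1 : G)) = id := by ext m; simp
        rw [this, CompletedPoly.rename_id]
        rfl
      map_mul' := fun g h => by
        refine RingHom.ext fun y => ?_
        obtain ⟨y, rfl⟩ := F.proj_surjective M y
        rw [RingHom.mul_def, RingHom.comp_apply, mapHom_proj, mapHom_proj, mapHom_proj,
          ← CompletedPoly.rename_comp]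
        congr 2
        congr 1
        ext m
        simp [mul_smul] }

end FormalGroup

section LocalizationAction

variable {G A : Type*} [Group G] [CommRing A] [MulSemiringAction G A]
  (T : Submonoid A) (hT : ∀ (g : G), ∀ t ∈ T, g • t ∈ T)

/-- The ring endomorphism `a / t ↦ (g • a) / (g • t)` of a localization. -/
def localizationHom (g : G) : Localization T →+* Localization T :=
  IsLocalization.map (Localization T) (MulSemiringAction.toRingHom G A g)
    (show T ≤ T.comap (MulSemiringAction.toRingHom G A g) from fun t ht => hT g t ht)

theorem localizationHom_algebraMap (g : G) (a : A) :
    localizationHom T hT g (algebraMap A (Localization T) a) =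
      algebraMap A (Localization T) (g • a) :=
  IsLocalization.map_eq _ _

/-- A group acting on a commutative ring and preserving a multiplicative subset acts on the
localization. -/
@[reducible]
def localizationAction : MulSemiringAction G (Localization T) :=
  MulSemiringAction.compHom (M := Localization T →+* Localization T) (Localization T)
    { toFun := localizationHom T hT
      map_one' := by
        refine IsLocalization.ringHom_ext T (RingHom.ext fun a => ?_)
        rw [RingHom.comp_apply, localizationHom_algebraMap, one_smul]
        rfl
      map_mul' := fun g h => by
        refine IsLocalization.ringHom_ext T (RingHom.ext fun a => ?_)
        rw [RingHom.comp_apply, RingHom.comp_apply, RingHom.mul_def, RingHom.comp_apply,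
          localizationHom_algebraMap, localizationHom_algebraMap, localizationHom_algebraMap,
          mul_smul] }

end LocalizationAction

/-! ## Generalized Cartan matrices, root data, Weyl groups -/

/-- Generalized Cartan matrices. -/
structure IsGenCartanMatrix {n : ℕ} (A : Matrix (Fin n) (Fin n) ℤ) : Prop where
  diag : ∀ i, A i i = 2
  nonpos : ∀ i j, i ≠ j → A i j ≤ 0
  zero_iff : ∀ i j, A i j = 0 ↔ A j i = 0

/-- A root datum of the generalized Cartan matrix `A`: a complex vector space `h` of dimension
`2n - rank A` with linearly independent simple roots in `h^*` and simple coroots in `h` such that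
`a_{ij} = ⟨α_j, α_i^∨⟩`. -/
structure KMRootDatum {n : ℕ} (A : Matrix (Fin n) (Fin n) ℤ) (h : Type*)
    [AddCommGroup h] [Module ℂ h] where
  isGenCartan : IsGenCartanMatrix A
  finite : Module.Finite ℂ h
  finrank_eq : Module.finrank ℂ h = 2 * n - (A.map (Int.cast : ℤ → ℂ)).rank
  root : Fin n → Module.Dual ℂ h
  coroot : Fin n → h
  root_indep : LinearIndependent ℂ root
  coroot_indep : LinearIndependent ℂ coroot
  pairing : ∀ i j, root j (coroot i) = (A i j : ℂ)

namespace KMRootDatum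

variable {n : ℕ} {A : Matrix (Fin n) (Fin n) ℤ} {h : Type*} [AddCommGroup h] [Module ℂ h]
  (D : KMRootDatum A h)

theorem root_coroot_two (i : Fin n) : Module.Dual.eval ℂ h (D.coroot i) (D.root i) = 2 := by
  rw [Module.Dual.eval_apply, D.pairing, D.isGenCartan.diag]
  norm_num

/-- The simple reflection `l ↦ l - ⟨l, α_i^∨⟩ α_i` of `h^*`. -/
def reflection (i : Fin n) : Module.Dual ℂ h ≃ₗ[ℂ] Module.Dual ℂ h :=
  Module.reflection (D.root_coroot_two i)

theorem reflection_apply (i : Fin n) (l : Module.Dual ℂ h) :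
    D.reflection i l = l - l (D.coroot i) • D.root i :=
  Module.reflection_apply _ _

theorem reflection_mul_self (i : Fin n) : D.reflection i * D.reflection i = 1 := by
  ext1 l
  exact Module.involutive_reflection (D.root_coroot_two i) l

/-- The Weyl group, generated by the simple reflections. -/
def weylGroup : Subgroup (Module.Dual ℂ h ≃ₗ[ℂ] Module.Dual ℂ h) :=
  Subgroup.closure (Set.range D.reflection)

/-- The simple reflection `s_i` as an element of the Weyl group. -/
def s (i : Fin n) : D.weylGroup := ⟨D.reflection i, Subgroup.subset_closure ⟨i, rfl⟩⟩

/-- The real roots `w(α_i)`. -/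
def realRoots : Set (Module.Dual ℂ h) :=
  {b | ∃ (w : D.weylGroup) (i : Fin n), b = (w : Module.Dual ℂ h ≃ₗ[ℂ] Module.Dual ℂ h) (D.root i)}

/-- The positive real roots. -/
def posRoots : Set (Module.Dual ℂ h) :=
  {b | b ∈ D.realRoots ∧ ∃ c : Fin n → ℕ, b = ∑ i, c i • D.root i}

/-- The product `s_{i_1} ⋯ s_{i_l}` of a sequence of indices. -/
def wordProd (I : List (Fin n)) : D.weylGroup := (I.map D.s).prod

/-- The length of `w`: the least `l` such that `w` is a product of `l` simple reflections. -/
def length (w : D.weylGroup) : ℕ := sInf {l | ∃ I : List (Fin n), D.wordProd I = w ∧ I.length = l}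

/-- `I` is a reduced sequence of `w`. -/
def IsReducedSeq (I : List (Fin n)) (w : D.weylGroup) : Prop :=
  D.wordProd I = w ∧ I.length = D.length w

theorem exists_word (w : D.weylGroup) : ∃ I : List (Fin n), D.wordProd I = w := by
  obtain ⟨w, hw⟩ := w
  have key : ∀ g ∈ D.weylGroup, ∃ I : List (Fin n), (D.wordProd I : _ ≃ₗ[ℂ] _) = g := by
    intro g hg
    induction hg using Subgroup.closure_induction'' with
    | mem _ hx =>
      obtain ⟨i, rfl⟩ := hx
      exact ⟨[i], by simp [wordProd, s]⟩
    | inv_mem _ hx =>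
      obtain ⟨i, rfl⟩ := hx
      refine ⟨[i], ?_⟩
      rw [← mul_eq_one_iff_eq_inv.1 (D.reflection_mul_self i)]
      simp [wordProd, s]
    | one => exact ⟨[], by simp [wordProd]⟩
    | mul x y _ _ hx hy =>
      obtain ⟨I, hI⟩ := hx
      obtain ⟨J, hJ⟩ := hy
      exact ⟨I ++ J, by simp [wordProd, ← hI, ← hJ]⟩
  obtain ⟨I, hI⟩ := key w hw
  exact ⟨I, Subtype.ext hI⟩

theorem exists_reducedSeq (w : D.weylGroup) : ∃ I : List (Fin n), D.IsReducedSeq I w :=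
  have hne : {l | ∃ I : List (Fin n), D.wordProd I = w ∧ I.length = l}.Nonempty :=
    let ⟨I, hI⟩ := D.exists_word w
    ⟨I.length, I, hI, rfl⟩
  Nat.sInf_mem hne

theorem finite_length_le (k : ℕ) : {w : D.weylGroup | D.length w ≤ k}.Finite := by
  refine ((List.finite_length_le (Fin n) k).image D.wordProd).subset ?_
  intro w hw
  obtain ⟨I, hI, hl⟩ := D.exists_reducedSeq w
  exact ⟨I, hl.trans_le hw, hI⟩

/-- The finite set of Weyl group elements of length at most `k`. -/
def lengthLE (k : ℕ) : Finset D.weylGroup := (D.finite_length_le k).toFinset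

/-- Formal Demazure lattices: finitely generated subgroups of `h^*` that pair integrally with the
coroot lattice and in which every simple root extends to a `ℤ`-basis. -/
structure DemazureLattice where
  carrier : AddSubgroup (Module.Dual ℂ h)
  fg : carrier.FG
  integral : ∀ l ∈ carrier, ∀ c ∈ AddSubgroup.closure (Set.range D.coroot), ∃ m : ℤ, l c = (m : ℂ)
  extends_to_basis : ∀ i, ∃ (r : ℕ) (b : Module.Basis (Fin r) ℤ carrier) (j : Fin r),
    (b j : Module.Dual ℂ h) = D.root i

namespace DemazureLattice

variable {D} (L : D.DemazureLattice)

theorem root_mem (i : Fin n) : D.root i ∈ L.carrier := by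
  obtain ⟨r, b, j, hj⟩ := L.extends_to_basis i
  rw [← hj]
  exact (b j).2

theorem reflection_mem (i : Fin n) {l : Module.Dual ℂ h} (hl : l ∈ L.carrier) :
    D.reflection i l ∈ L.carrier := by
  obtain ⟨m, hm⟩ := L.integral l hl (D.coroot i) (AddSubgroup.subset_closure ⟨i, rfl⟩)
  rw [D.reflection_apply, hm, Int.cast_smul_eq_zsmul]
  exact sub_mem hl (zsmul_mem (L.root_mem i) m)

theorem weyl_mem (w : D.weylGroup) {l : Module.Dual ℂ h} (hl : l ∈ L.carrier) :
    (w : Module.Dual ℂ h ≃ₗ[ℂ] Module.Dual ℂ h) l ∈ L.carrier := by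
  obtain ⟨I, rfl⟩ := D.exists_word w
  induction I generalizing l with
  | nil => simpa [wordProd] using hl
  | cons i I ih => simpa [wordProd, s] using L.reflection_mem i (ih hl)

/-- The action of the Weyl group on a Demazure lattice. -/
instance weylAction : DistribMulAction D.weylGroup L.carrier where
  smul w l := ⟨(w : Module.Dual ℂ h ≃ₗ[ℂ] Module.Dual ℂ h) l, L.weyl_mem w l.2⟩
  one_smul _ := rfl
  mul_smul _ _ _ := rfl
  smul_zero _ := Subtype.ext (map_zero _)
  smul_add _ _ _ := Subtype.ext (map_add _ _ _)

/-- The simple root `α_i` as an element of the lattice. -/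
def simpleRoot (i : Fin n) : L.carrier := ⟨D.root i, L.root_mem i⟩

variable {R : Type*} [CommRing R] (F : FormalGroup R)

/-- The formal group algebra `S = R⟦L⟧_F` of the lattice. -/
abbrev S : Type _ := F.FGAlgebra L.carrier

/-- The action `w • x_l = x_{w l}` of the Weyl group on `S`. -/
instance weylActionS : MulSemiringAction D.weylGroup (L.S F) := F.action D.weylGroup L.carrier

theorem smul_x (w : D.weylGroup) (l : L.carrier) :
    w • (F.x l : L.S F) = F.x (w • l) :=
  F.mapHom_x (DistribSMul.toAddMonoidHom L.carrier w) l

/-- The multiplicative subset of `S` generated by the `x_b`, `b` a real root. -/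
def rootMonoid : Submonoid (L.S F) :=
  Submonoid.closure {y | ∃ b : L.carrier, (b : Module.Dual ℂ h) ∈ D.realRoots ∧ y = F.x b}

theorem smul_mem_rootMonoid (w : D.weylGroup) (t : L.S F) (ht : t ∈ L.rootMonoid F) :
    w • t ∈ L.rootMonoid F := by
  induction ht using Submonoid.closure_induction with
  | mem y hy =>
    obtain ⟨b, ⟨v, i, hb⟩, rfl⟩ := hy
    refine Submonoid.subset_closure ⟨w • b, ⟨w * v, i, ?_⟩, L.smul_x F w b⟩
    change (w : Module.Dual ℂ h ≃ₗ[ℂ] Module.Dual ℂ h) b = _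
    rw [hb]
    rfl
  | one => rw [smul_one]; exact one_mem _
  | mul y z _ _ hy hz => rw [smul_mul']; exact mul_mem hy hz

/-- The localization `Q = S[1/x_b]` at all real roots `b`. A real root is positive or the negative
of a positive one, and `x_{-b}` is a unit multiple of `x_b` in `S`, so that this is the same as the
localization at the positive real roots. -/
def Q : Type _ := Localization (L.rootMonoid F)

instance : CommRing (L.Q F) := inferInstanceAs (CommRing (Localization (L.rootMonoid F)))

instance : Algebra (L.S F) (L.Q F) :=
  inferInstanceAs (Algebra (L.S F) (Localization (L.rootMonoid F)))

instance : IsLocalization (L.rootMonoid F) (L.Q F) :=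
  inferInstanceAs (IsLocalization (L.rootMonoid F) (Localization (L.rootMonoid F)))

/-- The action of the Weyl group on `Q`. -/
instance weylActionQ : MulSemiringAction D.weylGroup (L.Q F) :=
  localizationAction (L.rootMonoid F) (L.smul_mem_rootMonoid F)

theorem smul_algebraMap (w : D.weylGroup) (f : L.S F) :
    w • algebraMap (L.S F) (L.Q F) f = algebraMap (L.S F) (L.Q F) (w • f) :=
  localizationHom_algebraMap (L.rootMonoid F) (L.smul_mem_rootMonoid F) w f

/-- The twisted group algebra `Q_W`: the free left `Q`-module on `δ_w`, `w ∈ W`, with product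
`q δ_w ⬝ q' δ_{w'} = q w(q') δ_{w w'}`. -/
abbrev QW : Type _ := SkewMonoidAlgebra (L.Q F) D.weylGroup

/-- The basis element `δ_w` of `Q_W`. -/
def delta (w : D.weylGroup) : L.QW F := SkewMonoidAlgebra.single w 1

theorem x_simpleRoot_mem (i : Fin n) : (F.x (L.simpleRoot i) : L.S F) ∈ L.rootMonoid F :=
  Submonoid.subset_closure ⟨L.simpleRoot i, ⟨1, i, rfl⟩, rfl⟩

/-- The element `1 / x_{α_i}` of `Q`. -/
def invX (i : Fin n) : L.Q F :=
  IsLocalization.mk' (L.Q F) (1 : L.S F) (⟨F.x (L.simpleRoot i), L.x_simpleRoot_mem F i⟩ : L.rootMonoid F)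

/-- The formal Demazure element `X_i = (1 / x_{α_i}) (1 - δ_{s_i})`. -/
def demazure (i : Fin n) : L.QW F := L.invX F i • (1 - L.delta F (D.s i))

/-- `X_I = X_{i_1} ⋯ X_{i_l}` for a sequence `I = (i_1, …, i_l)`. -/
def demazureProd (I : List (Fin n)) : L.QW F := (I.map (L.demazure F)).prod

/-- The action of `Q_W` on `Q`, given by `(q δ_w) ⬝ q' = q w(q')`. -/
def act (z : L.QW F) (f : L.Q F) : L.Q F := z.sum fun w q => q * w • f

end DemazureLattice

end KMRootDatum

end

/-! Write α = u(α_i) and s_α = u s_i u⁻¹. The proof studies poles along x_α of the coefficients z_w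
of z = ∑ z_w δ_w in `Q_W`. Let M be the set of z such that every x_α z_w is regular along x_α (has a
denominator prime to x_α) and every z_w + z_{s_α w} is regular: at most simple poles, with residues
cancelling in pairs (`cancellingPoles`). M contains 1 and is stable under left multiplication by
regular elements and under right multiplication by every X_j, so it contains all combinations of the
X_I over S.

Suppose z is in M and z·S ⊆ x_α S. Then x_α⁻¹ z is again in M
(`smul_invX_smul_mem_cancellingPoles`). This is a form of independence of automorphisms
(`Prime.dvd_coeff_of_forall_sq_dvd_sum`). Modulo the prime x_α, two Weyl group elements act in the
same way only if they agree up to s_α, so the coefficients can be isolated in pairs w, s_α w. Within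
a pair, testing on f = 1 and f = x_α separates the two, because s_α(x_α) = x_{-α} is -x_α to first
order and 2 is not divisible by x_α.

It remains to read off the p_w, starting from a w of maximal length. The coefficient of X_{I_w} at w
is ± the inverse of the product of the x_β over the prefix roots β of the reduced word, and no other
term contributes at w or at longer elements. If α is a prefix root, this coefficient already has a
pole along x_α, while x_α⁻¹ z has only simple ones. If not, s_α w is longer than w, the coefficient
there is zero, and the cancellation condition makes x_α⁻¹ z_w regular. Both cases give x_α ∣ p_w.
The term x_α⁻¹ p_w X_{I_w} then lies in M and can be subtracted.

Two inputs are proved on the way. A ℤ-basis of Λ embeds S in a power series ring, the basis elements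
going to the variables; this makes x_α prime and describes S modulo x_α. For the Weyl group, length
controls the signs of roots, which gives the exchange property and shows that only 1 and s_α act
trivially modulo α. -/

/-! ### Power series: order filtration and substitution -/

namespace MvPowerSeries

variable {σ τ R : Type*} [CommRing R]

/-- The ideal of the power series without terms of degree less than `n`. -/
def orderIdeal (σ R : Type*) [CommRing R] (n : ℕ) : Ideal (MvPowerSeries σ R) where
  carrier := {f | n ≤ f.order}
  add_mem' hf hg := (le_min hf hg).trans min_order_le_add
  zero_mem' := by simp
  smul_mem' c f hf := by
    rw [smul_eq_mul]
    exact (le_trans hf (le_add_of_nonneg_left bot_le)).trans le_order_mul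

theorem mem_orderIdeal {n : ℕ} {f : MvPowerSeries σ R} :
    f ∈ orderIdeal σ R n ↔ (n : ℕ∞) ≤ f.order := Iff.rfl

theorem mem_orderIdeal_iff_coeff {n : ℕ} {f : MvPowerSeries σ R} :
    f ∈ orderIdeal σ R n ↔ ∀ e : σ →₀ ℕ, e.degree < n → coeff e f = 0 := by
  refine ⟨fun h e he => coeff_of_lt_order ?_, fun h => nat_le_order h⟩
  exact lt_of_lt_of_le (by exact_mod_cast he) h

theorem mem_orderIdeal_one {f : MvPowerSeries σ R} :
    f ∈ orderIdeal σ R 1 ↔ f.constantCoeff = 0 := by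
  rw [mem_orderIdeal, Nat.cast_one, one_le_order_iff_constCoeff_eq_zero]

theorem orderIdeal_antitone {m n : ℕ} (h : m ≤ n) : orderIdeal σ R n ≤ orderIdeal σ R m :=
  fun _ hf => le_trans (Nat.cast_le.2 h) (mem_orderIdeal.1 hf)

theorem orderIdeal_pow_le (m n : ℕ) : orderIdeal σ R m ^ n ≤ orderIdeal σ R (m * n) := by
  induction n with
  | zero => intro f _; simp [mem_orderIdeal]
  | succ n ih =>
    rw [pow_succ, Ideal.mul_le]
    intro f hf g hg
    rw [mem_orderIdeal, Nat.mul_succ, Nat.cast_add]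
    exact (add_le_add (ih hf) hg).trans le_order_mul

theorem eq_zero_of_forall_mem_orderIdeal {f : MvPowerSeries σ R}
    (h : ∀ n, f ∈ orderIdeal σ R n) : f = 0 := by
  ext e
  exact mem_orderIdeal_iff_coeff.1 (h (e.degree + 1)) e (Nat.lt_succ_self _)

theorem subst_mem_orderIdeal [Finite σ] {a : σ → MvPowerSeries τ R}
    (ha : ∀ i, (a i).constantCoeff = 0) {n : ℕ} {f : MvPowerSeries σ R}
    (hf : f ∈ orderIdeal σ R n) : f.subst a ∈ orderIdeal τ R n := by
  refine le_trans ?_ (le_order_subst (hasSubst_of_constantCoeff_zero ha) f)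
  have h1 : (1 : ℕ∞) ≤ ⨅ i, (a i).order :=
    le_iInf fun i => one_le_order_iff_constCoeff_eq_zero.2 (ha i)
  calc (n : ℕ∞) ≤ 1 * f.order := by rw [one_mul]; exact hf
    _ ≤ _ := mul_le_mul_left h1 _

/-- Monomials in the a_i depend, modulo an ideal, only on the classes of the a_i, and coefficients
of degree below n only see classes modulo order n. -/
theorem subst_sub_subst_mem_orderIdeal [Finite σ] {a b : σ → MvPowerSeries τ R}
    (ha : ∀ i, (a i).constantCoeff = 0) (hb : ∀ i, (b i).constantCoeff = 0) {n : ℕ}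
    (hab : ∀ i, a i - b i ∈ orderIdeal τ R n) (f : MvPowerSeries σ R) :
    f.subst a - f.subst b ∈ orderIdeal τ R n := by
  rw [mem_orderIdeal_iff_coeff]
  intro e he
  rw [map_sub, coeff_subst (hasSubst_of_constantCoeff_zero ha),
    coeff_subst (hasSubst_of_constantCoeff_zero hb), sub_eq_zero]
  refine finsum_congr fun d => ?_
  congr 1
  rw [← sub_eq_zero, ← map_sub]
  refine mem_orderIdeal_iff_coeff.1 ?_ e he
  rw [← Ideal.Quotient.eq, Finsupp.prod, Finsupp.prod, map_prod, map_prod]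
  refine Finset.prod_congr rfl fun i _ => ?_
  rw [map_pow, map_pow, Ideal.Quotient.eq.2 (hab i)]

theorem constantCoeff_update_X [DecidableEq σ] (j i : σ) :
    (Function.update (X : σ → MvPowerSeries σ R) j 0 i).constantCoeff = 0 := by
  rcases eq_or_ne i j with rfl | h
  · simp
  · simp [h]

/-- Setting X_j = 0 kills the monomials that contain X_j and fixes all others. -/
theorem X_dvd_sub_subst_update [Finite σ] [DecidableEq σ] (j : σ) (f : MvPowerSeries σ R) :
    X j ∣ f - f.subst (Function.update (X : σ → MvPowerSeries σ R) j 0) := by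
  rw [X_dvd_iff]
  intro e he
  rw [map_sub, coeff_subst (hasSubst_of_constantCoeff_zero (constantCoeff_update_X j)),
    sub_eq_zero]
  have hd : ∀ d : σ →₀ ℕ, (d.prod fun s n => Function.update (X : σ → MvPowerSeries σ R) j 0 s ^ n)
      = if d j = 0 then monomial d 1 else 0 := by
    intro d
    split_ifs with h
    · rw [monomial_one_eq]
      refine Finset.prod_congr rfl fun i hi => ?_
      have hij : i ≠ j := by
        rintro rfl
        exact (Finsupp.mem_support_iff.1 hi) h
      simp only [Function.update_of_ne hij]
    · refine Finset.prod_eq_zero (Finsupp.mem_support_iff.2 h) ?_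
      simp [h]
  classical
  rw [finsum_eq_single _ e]
  · simp [hd, he]
  · intro d hde
    rw [hd]
    split_ifs
    · simp [coeff_monomial, hde.symm]
    · simp

end MvPowerSeries

/-! ### The group of points of a formal group law in power series -/

namespace FormalGroup

open MvPowerSeries

variable {R : Type*} [CommRing R] {σ : Type*} (F : FormalGroup R)

/-- The sum `F(f, g)` of power series. -/
noncomputable abbrev add (f g : MvPowerSeries σ R) : MvPowerSeries σ R := F.toPowerSeries.subst ![f, g]

theorem constantCoeff_cons {f g : MvPowerSeries σ R} (hf : f.constantCoeff = 0)
    (hg : g.constantCoeff = 0) : ∀ i : Fin 2, (![f, g] i).constantCoeff = 0 := by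
  intro i
  fin_cases i
  · exact hf
  · exact hg

theorem constantCoeff_add {f g : MvPowerSeries σ R} (hf : f.constantCoeff = 0)
    (hg : g.constantCoeff = 0) : (F.add f g).constantCoeff = 0 :=
  constantCoeff_subst_eq_zero (hasSubst_of_constantCoeff_zero (constantCoeff_cons hf hg))
    (constantCoeff_cons hf hg) F.zero_constantCoeff

theorem hasSubst_of_zero {f : MvPowerSeries σ R} (hf : f.constantCoeff = 0) :
    PowerSeries.HasSubst f := by
  rw [PowerSeries.HasSubst, hf]
  exact IsNilpotent.zero

/-- The formal group law is addition to first order. -/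
theorem add_sub_mem_orderIdeal {m : ℕ} (hm : 1 ≤ m) {f g : MvPowerSeries σ R}
    (hf : f ∈ orderIdeal σ R m) (hg : g ∈ orderIdeal σ R m) :
    F.add f g - (f + g) ∈ orderIdeal σ R (m + 1) := by
  have hf0 := mem_orderIdeal_one.1 (orderIdeal_antitone hm hf)
  have hg0 := mem_orderIdeal_one.1 (orderIdeal_antitone hm hg)
  rw [mem_orderIdeal_iff_coeff]
  intro e he
  rw [map_sub, add, coeff_subst (hasSubst_of_constantCoeff_zero (constantCoeff_cons hf0 hg0)),
    finsum_eq_sum_of_support_subset (s := {Finsupp.single 0 1, Finsupp.single 1 1})]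
  · rw [Finset.sum_pair (by
      intro h
      simpa using DFunLike.congr_fun h 0)]
    simp [F.lin_coeff_X, F.lin_coeff_Y]
  · intro d hd
    by_contra hd'
    apply hd
    -- Outside the two linear exponents, either d = 0, where F has no constant term, or the monomial
    -- has order at least 2m ≥ m + 1; this uses 1 ≤ m.
    have hdeg : d = 0 ∨ 2 ≤ d 0 + d 1 := by
      by_contra! hcon
      apply hd'
      simp only [Finset.coe_insert, Finset.coe_singleton, Set.mem_insert_iff,
        Set.mem_singleton_iff]
      rcases Nat.lt_or_ge (d 0) 1 with h0 | h0
      · rcases Nat.lt_or_ge (d 1) 1 with h1 | h1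
        · exfalso
          apply hcon.1
          ext i
          fin_cases i <;> simp <;> omega
        · right
          ext i
          fin_cases i <;> simp <;> omega
      · left
        ext i
        fin_cases i <;> simp <;> omega
    rcases hdeg with rfl | hdeg
    · have h0 := F.zero_constantCoeff
      rw [← coeff_zero_eq_constantCoeff_apply] at h0
      simp only [h0, zero_smul]
    · have h2 : (d.prod fun s e => (![f, g] s) ^ e) ∈ orderIdeal σ R (m + 1) := by
        rw [Finsupp.prod_fintype _ _ (by simp), Fin.prod_univ_two]
        have := Ideal.mul_mem_mul (Ideal.pow_mem_pow hf (d 0)) (Ideal.pow_mem_pow hg (d 1))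
        rw [← pow_add] at this
        refine orderIdeal_antitone ?_ (orderIdeal_pow_le m _ this)
        nlinarith
      show _ • _ = _
      rw [mem_orderIdeal_iff_coeff.1 h2 e he, smul_zero]

theorem add_sub_add_mem_orderIdeal {n : ℕ} {f f' g g' : MvPowerSeries σ R}
    (hf : f.constantCoeff = 0) (hg : g.constantCoeff = 0) (hf' : f'.constantCoeff = 0)
    (hg' : g'.constantCoeff = 0) (h : f - f' ∈ orderIdeal σ R n) (h' : g - g' ∈ orderIdeal σ R n) :
    F.add f g - F.add f' g' ∈ orderIdeal σ R n := by
  refine subst_sub_subst_mem_orderIdeal (constantCoeff_cons hf hg)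
    (constantCoeff_cons hf' hg') (fun i => ?_) _
  fin_cases i
  · exact h
  · exact h'

/-- Approximations to the inverse of `f` for the formal group law. -/
noncomputable def invApprox (f : MvPowerSeries σ R) : ℕ → MvPowerSeries σ R
  | 0 => 0
  | n + 1 => F.add (invApprox f n) (-F.add f (invApprox f n))

theorem constantCoeff_invApprox {f : MvPowerSeries σ R} (hf : f.constantCoeff = 0) (n : ℕ) :
    (F.invApprox f n).constantCoeff = 0 := by
  induction n with
  | zero => simp [invApprox]
  | succ n ih =>
    exact F.constantCoeff_add ih (by rw [map_neg, F.constantCoeff_add hf ih, neg_zero])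

/-- If ε is the error at stage n, associativity makes the next error F(ε, -ε). Its first-order part
ε + (-ε) vanishes, so the order grows by one. -/
theorem add_invApprox_mem {f : MvPowerSeries σ R} (hf : f.constantCoeff = 0) (n : ℕ) :
    F.add f (F.invApprox f n) ∈ orderIdeal σ R (n + 1) := by
  induction n with
  | zero =>
    rw [invApprox, add, F.add_zero (hasSubst_of_zero hf)]
    exact mem_orderIdeal_one.2 hf
  | succ n ih =>
    have h0 := F.constantCoeff_invApprox hf n
    have h1 := F.constantCoeff_add hf h0
    have h := F.add_sub_mem_orderIdeal (Nat.le_add_left 1 n) ih (neg_mem ih)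
    rw [add_neg_cancel, sub_zero] at h
    rw [invApprox, add, ← F.assoc' (hasSubst_of_zero hf) (hasSubst_of_zero h0)
      (hasSubst_of_zero (by rw [map_neg, h1, neg_zero]))]
    exact h

theorem invApprox_succ_sub_mem {f : MvPowerSeries σ R} (hf : f.constantCoeff = 0) (n : ℕ) :
    F.invApprox f (n + 1) - F.invApprox f n ∈ orderIdeal σ R (n + 1) := by
  have h0 := F.constantCoeff_invApprox hf n
  have h1 := F.constantCoeff_add hf h0
  have h := F.add_sub_add_mem_orderIdeal (g := -F.add f (F.invApprox f n)) (g' := 0) h0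
    (by rw [map_neg, h1, neg_zero]) h0 (map_zero _) (n := n + 1)
    (by rw [sub_self]; exact zero_mem _)
    (by rw [sub_zero]; exact neg_mem (F.add_invApprox_mem hf n))
  have h2 : F.add (F.invApprox f n) 0 = F.invApprox f n := F.add_zero (hasSubst_of_zero h0)
  rwa [h2] at h

/-- The inverse of `f` for the formal group law. -/
noncomputable def inv (f : MvPowerSeries σ R) : MvPowerSeries σ R :=
  -- Approximations n and n + 1 agree in degrees up to n, so the coefficient at `e` is stable from
  -- index `e.degree` on.
  fun e => coeff e (F.invApprox f e.degree)

theorem inv_sub_invApprox_mem {f : MvPowerSeries σ R} (hf : f.constantCoeff = 0) (n : ℕ) :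
    F.inv f - F.invApprox f n ∈ orderIdeal σ R (n + 1) := by
  rw [mem_orderIdeal_iff_coeff]
  intro e he
  have key : ∀ k, F.invApprox f (e.degree + k) - F.invApprox f e.degree ∈
      orderIdeal σ R (e.degree + 1) := by
    intro k
    induction k with
    | zero => simp
    | succ k ih =>
      have := add_mem (orderIdeal_antitone (by omega)
        (F.invApprox_succ_sub_mem hf (e.degree + k))) ih
      rwa [sub_add_sub_cancel] at this
  obtain ⟨k, rfl⟩ := Nat.exists_eq_add_of_le (Nat.lt_succ_iff.1 he)
  have := mem_orderIdeal_iff_coeff.1 (key k) e (Nat.lt_succ_self _)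
  rw [map_sub, sub_eq_zero] at this ⊢
  rw [this]
  rfl

theorem constantCoeff_inv {f : MvPowerSeries σ R} (hf : f.constantCoeff = 0) :
    (F.inv f).constantCoeff = 0 := by
  have h := mem_orderIdeal_one.1 (F.inv_sub_invApprox_mem hf 0)
  rwa [invApprox, sub_zero] at h

theorem add_inv {f : MvPowerSeries σ R} (hf : f.constantCoeff = 0) : F.add f (F.inv f) = 0 := by
  refine eq_zero_of_forall_mem_orderIdeal fun n => orderIdeal_antitone (Nat.le_succ n) ?_
  have h := F.add_sub_add_mem_orderIdeal (n := n + 1) (f := f) (f' := f) hf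
    (F.constantCoeff_inv hf) hf (F.constantCoeff_invApprox hf n)
    (by rw [sub_self]; exact zero_mem _) (F.inv_sub_invApprox_mem hf n)
  have := add_mem h (F.add_invApprox_mem hf n)
  rwa [sub_add_cancel] at this

/-- The points of the formal group given by power series without constant term. -/
def ZeroPoint (_F : FormalGroup R) (σ : Type*) := {f : MvPowerSeries σ R // f.constantCoeff = 0}

noncomputable instance : Add (F.ZeroPoint σ) := ⟨fun f g => ⟨F.add f.1 g.1, F.constantCoeff_add f.2 g.2⟩⟩

instance : Zero (F.ZeroPoint σ) := ⟨⟨0, map_zero _⟩⟩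

noncomputable instance : Neg (F.ZeroPoint σ) := ⟨fun f => ⟨F.inv f.1, F.constantCoeff_inv f.2⟩⟩

noncomputable instance [F.IsComm] : AddCommGroup (F.ZeroPoint σ) where
  add_assoc f g h := Subtype.ext
    (F.assoc' (hasSubst_of_zero f.2) (hasSubst_of_zero g.2) (hasSubst_of_zero h.2))
  zero_add f := Subtype.ext (F.zero_add (hasSubst_of_zero f.2))
  add_zero f := Subtype.ext (F.add_zero (hasSubst_of_zero f.2))
  add_comm f g := Subtype.ext (F.comm' (hasSubst_of_zero f.2) (hasSubst_of_zero g.2))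
  neg_add_cancel f := Subtype.ext <|
    (F.comm' (hasSubst_of_zero (F.constantCoeff_inv f.2)) (hasSubst_of_zero f.2)).trans
      (F.add_inv f.2)
  nsmul := nsmulRec
  zsmul := zsmulRec

namespace ZeroPoint

variable {F}

theorem coe_add (f g : F.ZeroPoint σ) : (f + g).1 = F.add f.1 g.1 := rfl

theorem coe_zero : (0 : F.ZeroPoint σ).1 = 0 := rfl

variable [F.IsComm]

/-- The linear coefficient of a point at the variable `i`. -/
noncomputable def linCoeff (F : FormalGroup R) [F.IsComm] (i : σ) : F.ZeroPoint σ →+ R where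
  toFun f := coeff (Finsupp.single i 1) f.1
  map_zero' := by rw [coe_zero, map_zero]
  map_add' f g := by
    have h := F.add_sub_mem_orderIdeal le_rfl (mem_orderIdeal_one.2 f.2) (mem_orderIdeal_one.2 g.2)
    have := mem_orderIdeal_iff_coeff.1 h (Finsupp.single i 1) (by simp)
    rwa [map_sub, sub_eq_zero, map_add] at this

theorem linCoeff_apply (i : σ) (f : F.ZeroPoint σ) :
    linCoeff F i f = coeff (Finsupp.single i 1) f.1 := rfl

/-- The point given by a variable. -/
noncomputable def var (F : FormalGroup R) (i : σ) : F.ZeroPoint σ :=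
  ⟨MvPowerSeries.X i, constantCoeff_X i⟩

/-- Subtracting `F(f, g)` shows that `g` agrees with the inverse of `f` modulo `F(f, g)`. -/
theorem add_dvd_sub_neg (f g : F.ZeroPoint σ) : (f + g).1 ∣ g.1 - (-f).1 := by
  classical
  have h : g = -f + (f + g) := by rw [neg_add_cancel_left]
  -- F(X₀, X₁) - F(X₀, 0) = F(X₀, X₁) - X₀ is divisible by X₁; substitute (b, a).
  have key : ∀ a b : F.ZeroPoint σ, a.1 ∣ F.add b.1 a.1 - b.1 := by
    intro a b
    have hab := hasSubst_of_constantCoeff_zero (constantCoeff_cons b.2 a.2)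
    have h1 := X_dvd_sub_subst_update 1 F.toPowerSeries
    have h2 : Function.update (X : Fin 2 → MvPowerSeries (Fin 2) R) 1 0 = ![X 0, 0] := by
      ext1 i
      fin_cases i <;> simp
    have h3 : F.toPowerSeries.subst ![(X 0 : MvPowerSeries (Fin 2) R), 0] = X 0 :=
      F.add_zero (hasSubst_of_zero (constantCoeff_X _))
    rw [h2, h3] at h1
    have h4 := map_dvd (substAlgHom hab) h1
    rw [map_sub, substAlgHom_X, substAlgHom_X, substAlgHom_apply] at h4
    exact h4
  nth_rw 2 [h]
  exact key (f + g) (-f)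

end ZeroPoint

end FormalGroup

/-! ### Continuity of homomorphisms and comparison of filtrations -/

section FilteredHom

variable {A B P : Type*} [CommRing A] [CommRing B] [CommRing P]

/-- Ring homomorphisms that are compatible with filtrations agree if they agree on a dense
subring and the filtration of the target is separated. -/
theorem RingHom.eq_of_eq_on_dense (I : ℕ → Ideal A) (J : ℕ → Ideal B) (i : P →+* A)
    (hi : ∀ a n, ∃ p, a - i p ∈ I n) (hJ : ∀ b, (∀ n, b ∈ J n) → b = 0) {f g : A →+* B}
    (hf : ∀ n, ∀ a ∈ I n, f a ∈ J n) (hg : ∀ n, ∀ a ∈ I n, g a ∈ J n)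
    (h : f.comp i = g.comp i) : f = g := by
  ext a
  rw [← sub_eq_zero]
  refine hJ _ fun n => ?_
  obtain ⟨p, hp⟩ := hi a n
  have hfg : f (i p) = g (i p) := RingHom.congr_fun h p
  have := sub_mem (hf n _ hp) (hg n _ hp)
  rwa [map_sub, map_sub, hfg, sub_sub_sub_cancel_right] at this

end FilteredHom

namespace MvPowerSeries

variable {σ τ R B : Type*} [CommRing R] [CommRing B] [Finite σ]

theorem sub_truncTotal_mem_orderIdeal (f : MvPowerSeries σ R) (n : ℕ) :
    f - (truncTotal n f : MvPolynomial σ R) ∈ orderIdeal σ R n := by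
  rw [mem_orderIdeal_iff_coeff]
  intro e he
  rw [map_sub, MvPolynomial.coeff_coe, coeff_truncTotal _ he, sub_self]

theorem ringHom_ext_of_filtered (J : ℕ → Ideal B) (hJ : ∀ b, (∀ n, b ∈ J n) → b = 0)
    {f g : MvPowerSeries σ R →+* B} (hf : ∀ n, ∀ a ∈ orderIdeal σ R n, f a ∈ J n)
    (hg : ∀ n, ∀ a ∈ orderIdeal σ R n, g a ∈ J n) (hC : ∀ r, f (C r) = g (C r))
    (hX : ∀ i, f (X i) = g (X i)) : f = g := by
  refine RingHom.eq_of_eq_on_dense (orderIdeal σ R) J MvPolynomial.coeToMvPowerSeries.ringHom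
    (fun a n => ⟨truncTotal n a, sub_truncTotal_mem_orderIdeal a n⟩) hJ hf hg ?_
  refine MvPolynomial.ringHom_ext (fun r => ?_) fun i => ?_
  · simpa using hC r
  · simpa using hX i

theorem trunc_toAdicCompletion (n : ℕ) (f : MvPowerSeries σ R) :
    CompletedPoly.trunc R σ n (toAdicCompletion σ R f) =
      Ideal.Quotient.mk _ (truncTotal n f) := by
  change AdicCompletion.evalₐ _ n (toAdicCompletion σ R f) = _
  rw [toAdicCompletion, AdicCompletion.evalₐ_liftAlgHom]
  · rfl
  · exact fun h => AlgHom.ext fun _ => by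
      simpa [Ideal.Quotient.mk_eq_mk_iff_sub_mem] using
        truncTotal_sub_truncTotal_mem_pow_idealOfVars h (le_refl _) _

/-- Translates between the degree filtration of the completion and the order filtration of power
series, on which the continuity arguments below rest. -/
theorem trunc_toAdicCompletion_eq_zero_iff {n : ℕ} {f : MvPowerSeries σ R} :
    CompletedPoly.trunc R σ n (toAdicCompletion σ R f) = 0 ↔ f ∈ orderIdeal σ R n := by
  rw [trunc_toAdicCompletion, Ideal.Quotient.eq_zero_iff_mem,
    MvPolynomial.mem_pow_idealOfVars_iff', mem_orderIdeal_iff_coeff]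
  refine forall₂_congr fun e he => ?_
  rw [coeff_truncTotal _ he]

end MvPowerSeries

namespace CompletedPoly

variable (R : Type*) [CommRing R] {M : Type*}

/-- The inclusion of the polynomial ring into the power series ring. -/
noncomputable def ofPoly (M : Type*) : MvPolynomial M R →+* CompletedPoly R M :=
  algebraMap _ _

theorem ofPoly_apply (p : MvPolynomial M R) : ofPoly R M p =
    AdicCompletion.of (MvPolynomial.idealOfVars M R) (MvPolynomial M R) p := rfl

theorem trunc_ofPoly (n : ℕ) (p : MvPolynomial M R) :
    trunc R M n (ofPoly R M p) = Ideal.Quotient.mk _ p := by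
  rw [ofPoly_apply]
  simp [trunc]

theorem exists_sub_ofPoly_mem_ker (y : CompletedPoly R M) (n : ℕ) :
    ∃ p, y - ofPoly R M p ∈ RingHom.ker (trunc R M n) := by
  obtain ⟨p, hp⟩ := Ideal.Quotient.mk_surjective (trunc R M n y)
  refine ⟨p, ?_⟩
  rw [RingHom.mem_ker, map_sub, trunc_ofPoly, hp, sub_self]

theorem rename_toAdicCompletion_C {σ : Type*} [Finite σ] (a : σ → M) (r : R) :
    rename R a (MvPowerSeries.toAdicCompletion σ R (MvPowerSeries.C r)) =
      ofPoly R M (MvPolynomial.C r) := by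
  refine ext_trunc R fun d => ?_
  rw [trunc_rename, ← MvPolynomial.coe_C, MvPowerSeries.toAdicCompletion_coe, trunc_ofPoly]
  have := trunc_ofPoly R d (MvPolynomial.C r : MvPolynomial σ R)
  rw [ofPoly_apply] at this
  rw [this]
  simp [renameQuot]

theorem rename_toAdicCompletion_X {σ : Type*} [Finite σ] (a : σ → M) (i : σ) :
    rename R a (MvPowerSeries.toAdicCompletion σ R (MvPowerSeries.X i)) = X R (a i) := by
  rw [← rename_X, ← MvPolynomial.coe_X, MvPowerSeries.toAdicCompletion_coe]
  rfl

end CompletedPoly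

/-! ### Evaluation of power series in the formal group algebra -/

namespace FormalGroup

open MvPowerSeries

variable {R : Type*} [CommRing R] (F : FormalGroup R) {M : Type*} [AddCommGroup M]

/-- The ideal of the elements of the formal group algebra represented by series without terms of
degree less than `d`. -/
noncomputable def filtration (M : Type*) [AddCommGroup M] (d : ℕ) : Ideal (F.FGAlgebra M) :=
  (RingHom.ker (CompletedPoly.trunc R M d)).map (F.proj M)

theorem proj_mem_filtration {d : ℕ} {y : CompletedPoly R M}
    (hy : CompletedPoly.trunc R M d y = 0) : F.proj M y ∈ F.filtration M d :=
  Ideal.mem_map_of_mem _ hy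

theorem proj_eq_zero_iff {y : CompletedPoly R M} : F.proj M y = 0 ↔ y ∈ F.relIdeal M :=
  Ideal.Quotient.eq_zero_iff_mem

/-- Separatedness holds because the relation ideal is closed. It allows continuous maps into the
algebra to be compared on polynomials. -/
theorem eq_zero_of_forall_mem_filtration (y : F.FGAlgebra M) (h : ∀ d, y ∈ F.filtration M d) :
    y = 0 := by
  obtain ⟨c, rfl⟩ := F.proj_surjective M y
  rw [proj_eq_zero_iff, relIdeal, CompletedPoly.closure, Ideal.mem_iInf]
  intro d
  obtain ⟨k, hk, hkc⟩ := (Ideal.mem_map_iff_of_surjective _ (F.proj_surjective M)).1 (h d)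
  have h1 : c - k ∈ F.relIdeal M := by rw [← proj_eq_zero_iff, map_sub, hkc, sub_self]
  rw [relIdeal, CompletedPoly.closure, Ideal.mem_iInf] at h1
  rw [← sub_add_cancel c k]
  exact add_mem (h1 d) (Ideal.mem_sup_right hk)

theorem proj_eq_zero_of_mem_span {y : CompletedPoly R M}
    (hy : y ∈ Ideal.span ({CompletedPoly.X R 0} ∪ {y | ∃ l m : M, y =
      CompletedPoly.X R (l + m) - CompletedPoly.eval₂ F.toPowerSeries l m})) :
    F.proj M y = 0 := by
  rw [proj_eq_zero_iff, relIdeal, CompletedPoly.closure, Ideal.mem_iInf]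
  exact fun d => Ideal.mem_sup_left hy

theorem x_zero : F.x (0 : M) = 0 :=
  F.proj_eq_zero_of_mem_span (Ideal.subset_span (Or.inl rfl))

theorem proj_eval₂ (l m : M) :
    F.proj M (CompletedPoly.eval₂ F.toPowerSeries l m) = F.x (l + m) := by
  symm
  rw [x, ← sub_eq_zero, ← map_sub]
  exact F.proj_eq_zero_of_mem_span (Ideal.subset_span (Or.inr ⟨l, m, rfl⟩))

/-- Constants in the formal group algebra. -/
noncomputable def const (M : Type*) [AddCommGroup M] : R →+* F.FGAlgebra M :=
  (F.proj M).comp ((CompletedPoly.ofPoly R M).comp MvPolynomial.C)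

/-- Negation of points is substitution into a power series in one variable. -/
theorem ZeroPoint.coe_neg_eq_subst {F : FormalGroup R} [F.IsComm] {σ : Type*}
    (f : F.ZeroPoint σ) :
    (-f).1 = (-ZeroPoint.var F (0 : Fin 1)).1.subst (fun _ : Fin 1 => f.1) := by
  have hs : HasSubst (fun _ : Fin 1 => f.1) := hasSubst_of_constantCoeff_zero fun _ => f.2
  have h0 : ZeroPoint.var F (0 : Fin 1) + -ZeroPoint.var F (0 : Fin 1) = 0 := add_neg_cancel _
  generalize -ZeroPoint.var F (0 : Fin 1) = Y at h0 ⊢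
  have h2 : subst ![X 0, Y.1] F.toPowerSeries = 0 := congrArg Subtype.val h0
  have h3 := congrArg (subst (fun _ : Fin 1 => f.1)) h2
  rw [subst_comp_subst_apply (hasSubst_of_constantCoeff_zero
    (constantCoeff_cons (constantCoeff_X 0) Y.2)) hs, ← substAlgHom_apply hs 0, map_zero] at h3
  have h4 : (fun i => subst (fun _ : Fin 1 => f.1) (![X 0, Y.1] i)) =
      ![f.1, Y.1.subst fun _ : Fin 1 => f.1] := by
    refine funext (Fin.forall_fin_two.2 ⟨?_, rfl⟩)
    rw [Matrix.cons_val_zero, subst_X hs, Matrix.cons_val_zero]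
  rw [h4] at h3
  -- Substituting f for X in F(X, Y(X)) = 0 makes Y(f) an inverse of f, and inverses in the group of
  -- points are unique.
  have h1 : f + ⟨Y.1.subst (fun _ : Fin 1 => f.1),
    constantCoeff_subst_eq_zero hs (fun _ => f.2) Y.2⟩ = 0 := Subtype.ext h3
  have h5 := neg_eq_of_add_eq_zero_right h1
  exact congrArg Subtype.val h5

section ev

variable {σ : Type*} [Finite σ]

/-- The evaluation of power series at a finite family of elements `x_m`. -/
noncomputable def ev (a : σ → M) : MvPowerSeries σ R →+* F.FGAlgebra M :=
  (F.proj M).comp ((CompletedPoly.rename R a).comp (toAdicCompletion σ R : _ →+* _))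

theorem ev_C (a : σ → M) (r : R) : F.ev a (C r) = F.const M r :=
  congrArg (F.proj M) (CompletedPoly.rename_toAdicCompletion_C R a r)

theorem ev_X (a : σ → M) (i : σ) : F.ev a (X i) = F.x (a i) :=
  congrArg (F.proj M) (CompletedPoly.rename_toAdicCompletion_X R a i)

theorem ev_mem_filtration (a : σ → M) (n : ℕ) (f : MvPowerSeries σ R)
    (hf : f ∈ orderIdeal σ R n) : F.ev a f ∈ F.filtration M n := by
  refine F.proj_mem_filtration ?_
  rw [RingHom.comp_apply, CompletedPoly.trunc_rename]
  erw [trunc_toAdicCompletion_eq_zero_iff.2 hf]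
  rw [map_zero]

theorem ev_toPowerSeries (l m : M) : F.ev ![l, m] F.toPowerSeries = F.x (l + m) :=
  F.proj_eval₂ l m

/-- Evaluation commutes with substitution. -/
theorem ev_subst {τ : Type*} [Finite τ] (a : σ → M) (b : τ → M) {f : τ → MvPowerSeries σ R}
    (hf : ∀ i, (f i).constantCoeff = 0) (h : ∀ i, F.ev a (f i) = F.x (b i))
    (g : MvPowerSeries τ R) : F.ev a (g.subst f) = F.ev b g := by
  have hs := hasSubst_of_constantCoeff_zero hf
  have : (F.ev a).comp (substAlgHom (R := R) hs : _ →+* _) = F.ev b := by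
    refine ringHom_ext_of_filtered (F.filtration M) F.eq_zero_of_forall_mem_filtration
      (fun n g hg => ?_) (F.ev_mem_filtration b) (fun r => ?_) fun i => ?_
    · refine F.ev_mem_filtration a n _ ?_
      rw [RingHom.coe_coe, substAlgHom_apply]
      exact subst_mem_orderIdeal hf hg
    · rw [RingHom.comp_apply, RingHom.coe_coe, substAlgHom_apply, subst_C, ev_C, ev_C]
    · rw [RingHom.comp_apply, RingHom.coe_coe, substAlgHom_X, h, ev_X]
  rw [← this, RingHom.comp_apply, RingHom.coe_coe, substAlgHom_apply]

theorem mapHom_ev {N : Type*} [AddCommGroup N] (e : M →+ N) (a : σ → M) (g : MvPowerSeries σ R) :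
    F.mapHom e (F.ev a g) = F.ev (e ∘ a) g := by
  rw [ev, RingHom.comp_apply, mapHom_proj, RingHom.comp_apply, ← CompletedPoly.rename_comp]
  rfl

end ev

section basis

variable [F.IsComm] {ι : Type*} (b : Module.Basis ι ℤ M)

/-- The group homomorphism to the points of the formal group that sends the basis to the
variables. -/
noncomputable def point : M →+ F.ZeroPoint ι :=
  (b.constr ℤ (ZeroPoint.var F)).toAddMonoidHom

theorem point_basis (i : ι) : F.point b (b i) = ZeroPoint.var F i :=
  b.constr_basis ℤ _ i

/-- The good m form a subgroup containing the basis. Sums are covered by the defining relations;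
negatives are not, and have to be extracted from x_0 = 0. -/
theorem ev_basis_point [Finite ι] (m : M) : F.ev b (F.point b m).1 = F.x m := by
  have hb : ∀ i, F.ev b (F.point b (b i)).1 = F.x (b i) := fun i => by
    rw [point_basis]
    exact F.ev_X b i
  have hadd : ∀ l m : M, F.ev b (F.point b l).1 = F.x l → F.ev b (F.point b m).1 = F.x m →
      F.ev b (F.point b (l + m)).1 = F.x (l + m) := by
    intro l m hl hm
    rw [map_add, ZeroPoint.coe_add, ← ev_toPowerSeries]
    refine F.ev_subst b ![l, m] (constantCoeff_cons (F.point b l).2 (F.point b m).2)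
      (fun i => ?_) _
    fin_cases i
    · exact hl
    · exact hm
  have hneg : ∀ m : M, F.ev b (F.point b m).1 = F.x m →
      F.ev b (F.point b (-m)).1 = F.x (-m) := by
    intro m hm
    let u : F.ZeroPoint (Fin 2) := ZeroPoint.var F 0
    let v : F.ZeroPoint (Fin 2) := ZeroPoint.var F 1
    -- At (x_m, x_{-m}) the divisor F(u, v) becomes x_0 = 0, so x_{-m} is the formal inverse of x_m.
    have h1 := map_dvd (F.ev ![m, -m]) (ZeroPoint.add_dvd_sub_neg u v)
    have h2 : F.ev ![m, -m] (u + v).1 = 0 := by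
      rw [ZeroPoint.coe_add, F.ev_subst ![m, -m] ![m, -m] (constantCoeff_cons u.2 v.2),
        ev_toPowerSeries, add_neg_cancel, x_zero]
      intro i
      fin_cases i
      · exact F.ev_X _ 0
      · exact F.ev_X _ 1
    rw [h2, zero_dvd_iff, map_sub, sub_eq_zero] at h1
    have h3 : F.ev ![m, -m] v.1 = F.x (-m) := F.ev_X _ 1
    have h4 : F.ev ![m, -m] (-u).1 = F.ev (fun _ : Fin 1 => m) (-ZeroPoint.var F (0 : Fin 1)).1 := by
      rw [ZeroPoint.coe_neg_eq_subst]
      exact F.ev_subst ![m, -m] _ (fun _ => u.2) (fun _ => F.ev_X _ 0) _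
    rw [← h3, h1, h4, map_neg, ZeroPoint.coe_neg_eq_subst]
    exact F.ev_subst b _ (fun _ => (F.point b m).2) (fun _ => hm) _
  let T : AddSubgroup M :=
    { carrier := {m | F.ev b (F.point b m).1 = F.x m}
      add_mem' := fun {l m} => hadd l m
      zero_mem' := by
        rw [Set.mem_ofPred_eq, map_zero, ZeroPoint.coe_zero, map_zero, x_zero]
      neg_mem' := fun {m} => hneg m }
  have hT : (⊤ : Submodule ℤ M) ≤ T.toIntSubmodule := by
    rw [← b.span_eq, Submodule.span_le]
    rintro _ ⟨i, rfl⟩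
    exact hb i
  exact hT (x := m) trivial

end basis

end FormalGroup

/-! ### Substitution of power series for arbitrarily many variables -/

namespace CompletedPoly

open MvPowerSeries

theorem factorPow_trunc (R : Type*) [CommRing R] {M : Type*} {d e : ℕ} (hde : d ≤ e)
    (y : CompletedPoly R M) :
    Ideal.Quotient.factorPow (MvPolynomial.idealOfVars M R) hde (trunc R M e y) =
      trunc R M d y := by
  have := RingHom.congr_fun (renameQuot_compat R (id : M → M) hde) y
  rwa [RingHom.comp_apply, RingHom.comp_apply, RingHom.comp_apply, renameQuot_id,
    renameQuot_id] at this

variable {R : Type*} [CommRing R] {M ι : Type*} [Finite ι]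
  (f : M → MvPowerSeries ι R)
  (hf : ∀ m, (f m).constantCoeff = 0)

/-- Substitution of power series into polynomials, modulo terms of degree `≥ d`. -/
noncomputable def substPoly (d : ℕ) :
    MvPolynomial M R →+* MvPolynomial ι R ⧸ MvPolynomial.idealOfVars ι R ^ d :=
  (truncTotalAlgHom ι R d).toRingHom.comp (MvPolynomial.aeval (R := R) f).toRingHom

theorem substPoly_apply (d : ℕ) (p : MvPolynomial M R) :
    substPoly f d p = Ideal.Quotient.mk _ (truncTotal d (MvPolynomial.aeval (R := R) f p)) := rfl

include hf

omit [Finite ι] in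
theorem aeval_mem_orderIdeal {d : ℕ} {p : MvPolynomial M R}
    (hp : p ∈ MvPolynomial.idealOfVars M R ^ d) :
    MvPolynomial.aeval (R := R) f p ∈ orderIdeal ι R d := by
  have h1 : (MvPolynomial.idealOfVars M R ^ d).map (MvPolynomial.aeval (R := R) f) ≤
      orderIdeal ι R d := by
    have h2 := orderIdeal_pow_le (σ := ι) (R := R) 1 d
    rw [one_mul] at h2
    rw [Ideal.map_pow]
    refine le_trans (Ideal.pow_right_mono ?_ _) h2
    rw [Ideal.map_span, Ideal.span_le]
    rintro _ ⟨_, ⟨m, rfl⟩, rfl⟩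
    rw [MvPolynomial.aeval_X]
    exact mem_orderIdeal_one.2 (hf m)
  exact h1 (Ideal.mem_map_of_mem _ hp)

theorem substPoly_eq_zero (d : ℕ) (p : MvPolynomial M R)
    (hp : p ∈ MvPolynomial.idealOfVars M R ^ d) : substPoly f d p = 0 := by
  rw [substPoly_apply, ← trunc_toAdicCompletion, trunc_toAdicCompletion_eq_zero_iff]
  exact aeval_mem_orderIdeal f hf hp

/-- Substitution of power series without constant term, modulo terms of degree `≥ d`. -/
noncomputable def substTrunc (d : ℕ) :
    CompletedPoly R M →+* MvPolynomial ι R ⧸ MvPolynomial.idealOfVars ι R ^ d :=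
  (Ideal.Quotient.lift _ (substPoly f d) (substPoly_eq_zero f hf d)).comp (trunc R M d)

theorem substTrunc_compat {d e : ℕ} (hde : d ≤ e) :
    (Ideal.Quotient.factorPow (MvPolynomial.idealOfVars ι R) hde).comp (substTrunc f hf e) =
      substTrunc f hf d := by
  ext y
  obtain ⟨p, hp⟩ := exists_sub_ofPoly_mem_ker R y e
  rw [RingHom.mem_ker, map_sub, sub_eq_zero, trunc_ofPoly] at hp
  have hp' : trunc R M d y = Ideal.Quotient.mk _ p := by
    rw [← factorPow_trunc R hde, hp]
    erw [Ideal.Quotient.factor_mk]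
  rw [RingHom.comp_apply, substTrunc, substTrunc, RingHom.comp_apply, RingHom.comp_apply, hp, hp',
    Ideal.Quotient.lift_mk, Ideal.Quotient.lift_mk, substPoly_apply, substPoly_apply]
  erw [Ideal.Quotient.factor_mk]
  rw [Ideal.Quotient.eq]
  exact truncTotal_sub_truncTotal_mem_pow_idealOfVars hde le_rfl _

/-- The continuous substitution of power series without constant term. -/
noncomputable def subst : CompletedPoly R M →+* MvPowerSeries ι R :=
  ((toAdicCompletionAlgEquiv ι R).symm : CompletedPoly R ι →+* MvPowerSeries ι R).comp
    (AdicCompletion.liftRingHom (MvPolynomial.idealOfVars ι R) (substTrunc f hf)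
      (substTrunc_compat f hf))

theorem trunc_toAdicCompletion_subst (d : ℕ) (y : CompletedPoly R M) :
    trunc R ι d (toAdicCompletion ι R (subst f hf y)) = substTrunc f hf d y := by
  have h : toAdicCompletion ι R (subst f hf y) =
    AdicCompletion.liftRingHom (MvPolynomial.idealOfVars ι R) (substTrunc f hf)
      (substTrunc_compat f hf) y := (toAdicCompletionAlgEquiv ι R).apply_symm_apply _
  rw [h]
  exact AdicCompletion.evalₐ_liftRingHom _ _ (substTrunc_compat f hf) _ _

theorem subst_mem_orderIdeal (d : ℕ) (y : CompletedPoly R M)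
    (hy : y ∈ RingHom.ker (trunc R M d)) : subst f hf y ∈ orderIdeal ι R d := by
  rw [← trunc_toAdicCompletion_eq_zero_iff, trunc_toAdicCompletion_subst, substTrunc,
    RingHom.comp_apply, RingHom.mem_ker.1 hy, map_zero]

theorem subst_ofPoly (p : MvPolynomial M R) :
    subst f hf (ofPoly R M p) = MvPolynomial.aeval (R := R) f p := by
  rw [← sub_eq_zero]
  refine eq_zero_of_forall_mem_orderIdeal fun d => ?_
  rw [← trunc_toAdicCompletion_eq_zero_iff, map_sub, map_sub, trunc_toAdicCompletion_subst,
    substTrunc, RingHom.comp_apply, trunc_ofPoly, Ideal.Quotient.lift_mk, substPoly_apply,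
    trunc_toAdicCompletion, sub_self]

theorem subst_X (m : M) : subst f hf (X R m) = f m :=
  (subst_ofPoly f hf (MvPolynomial.X m)).trans (MvPolynomial.aeval_X _ _)

/-- Substitution into a series in finitely many of the variables. -/
theorem subst_rename_toAdicCompletion {σ : Type*} [Finite σ] (a : σ → M) (g : MvPowerSeries σ R) :
    subst f hf (rename R a (toAdicCompletion σ R g)) = g.subst (f ∘ a) := by
  have hs : HasSubst (f ∘ a) := hasSubst_of_constantCoeff_zero fun i => hf (a i)
  have : (subst f hf).comp ((rename R a).comp (toAdicCompletion σ R).toRingHom) =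
      (substAlgHom (R := R) hs).toRingHom := by
    refine ringHom_ext_of_filtered (orderIdeal ι R) (fun _ => eq_zero_of_forall_mem_orderIdeal)
      (fun n g hg => ?_) (fun n g hg => ?_) (fun r => ?_) fun i => ?_
    · refine subst_mem_orderIdeal f hf n _ ?_
      rw [RingHom.mem_ker, RingHom.comp_apply, trunc_rename]
      erw [trunc_toAdicCompletion_eq_zero_iff.2 hg]
      rw [map_zero]
    · rw [AlgHom.toRingHom_eq_coe, RingHom.coe_coe, substAlgHom_apply]
      exact MvPowerSeries.subst_mem_orderIdeal (fun i => hf (a i)) hg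
    · refine (congrArg _ (rename_toAdicCompletion_C R a r)).trans ((subst_ofPoly f hf _).trans ?_)
      rw [MvPolynomial.aeval_C, AlgHom.toRingHom_eq_coe, RingHom.coe_coe, substAlgHom_apply,
        subst_C]
      simp [MvPowerSeries.algebraMap_apply]
    · refine (congrArg _ (rename_toAdicCompletion_X R a i)).trans ((subst_X f hf _).trans ?_)
      rw [AlgHom.toRingHom_eq_coe, RingHom.coe_coe, substAlgHom_X]
      rfl
  exact (RingHom.congr_fun this g).trans (substAlgHom_apply hs g)

end CompletedPoly

/-! ### Coordinates for a free group, and the prime attached to a basis element -/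

namespace FormalGroup

open MvPowerSeries

variable {R : Type*} [CommRing R] (F : FormalGroup R) [F.IsComm] {M : Type*} [AddCommGroup M]
  {ι : Type*} [Finite ι] (b : Module.Basis ι ℤ M)

/-- The substitution `x_m ↦ F.point m` into power series. -/
noncomputable def coordSeries : CompletedPoly R M →+* MvPowerSeries ι R :=
  CompletedPoly.subst (fun m => (F.point b m).1) (fun m => (F.point b m).2)

/-- The generating relations become identities in the group of points; continuity and separatedness
extend this to the closure. -/
theorem relIdeal_le_ker_coordSeries : F.relIdeal M ≤ RingHom.ker (F.coordSeries b) := by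
  intro y hy
  rw [RingHom.mem_ker]
  refine eq_zero_of_forall_mem_orderIdeal fun d => ?_
  rw [relIdeal, CompletedPoly.closure, Ideal.mem_iInf] at hy
  obtain ⟨j, hj, k, hk, rfl⟩ := Submodule.mem_sup.1 (hy d)
  have h1 : Ideal.span ({CompletedPoly.X R 0} ∪ {y | ∃ l m : M, y = CompletedPoly.X R (l + m) -
      CompletedPoly.eval₂ F.toPowerSeries l m}) ≤ RingHom.ker (F.coordSeries b) := by
    rw [Ideal.span_le]
    rintro _ (rfl | ⟨l, m, rfl⟩)
    · rw [SetLike.mem_coe, RingHom.mem_ker, coordSeries, CompletedPoly.subst_X, map_zero,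
        ZeroPoint.coe_zero]
    · rw [SetLike.mem_coe, RingHom.mem_ker, map_sub, sub_eq_zero, coordSeries,
        CompletedPoly.subst_X, CompletedPoly.eval₂, CompletedPoly.subst_rename_toAdicCompletion,
        map_add, ZeroPoint.coe_add, add]
      congr 1
      exact funext (Fin.forall_fin_two.2 ⟨rfl, rfl⟩)
  rw [map_add, RingHom.mem_ker.1 (h1 hj), _root_.zero_add]
  exact CompletedPoly.subst_mem_orderIdeal _ _ d k hk

/-- The coordinates of the formal group algebra of a free group: the isomorphism with the power
series ring. -/
noncomputable def coord : F.FGAlgebra M →+* MvPowerSeries ι R :=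
  Ideal.Quotient.lift (F.relIdeal M) (F.coordSeries b) (F.relIdeal_le_ker_coordSeries b)

theorem coord_proj (y : CompletedPoly R M) : F.coord b (F.proj M y) = F.coordSeries b y :=
  Ideal.Quotient.lift_mk _ _ _

theorem coord_x (m : M) : F.coord b (F.x m) = (F.point b m).1 :=
  (F.coord_proj b _).trans (CompletedPoly.subst_X _ _ m)

/-- Both sides are continuous in y and agree on constants and on the x_m. This one-sided inverse is
all that is used of the isomorphism with power series. -/
theorem ev_coord (y : F.FGAlgebra M) : F.ev b (F.coord b y) = y := by
  obtain ⟨y, rfl⟩ := F.proj_surjective M y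
  have : (F.ev b).comp (F.coordSeries b) = F.proj M := by
    refine RingHom.eq_of_eq_on_dense (fun n => RingHom.ker (CompletedPoly.trunc R M n))
      (F.filtration M) (CompletedPoly.ofPoly R M) (CompletedPoly.exists_sub_ofPoly_mem_ker R)
      F.eq_zero_of_forall_mem_filtration (fun n y hy => ?_) (fun n y hy => ?_) ?_
    · exact F.ev_mem_filtration b n _ (CompletedPoly.subst_mem_orderIdeal _ _ n y hy)
    · exact F.proj_mem_filtration hy
    · refine MvPolynomial.ringHom_ext (fun r => ?_) fun m => ?_
      · rw [RingHom.comp_apply, RingHom.comp_apply, coordSeries, CompletedPoly.subst_ofPoly,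
          MvPolynomial.aeval_C]
        exact F.ev_C b r
      · rw [RingHom.comp_apply, RingHom.comp_apply, coordSeries, CompletedPoly.subst_ofPoly,
          MvPolynomial.aeval_X, ev_basis_point]
        rfl
  rw [coord_proj]
  exact RingHom.congr_fun this y

theorem coord_injective : Function.Injective (F.coord b) :=
  Function.LeftInverse.injective (F.ev_coord b)

theorem coord_x_basis (i : ι) : F.coord b (F.x (b i)) = X i := by
  rw [coord_x, point_basis]
  rfl

include b in
theorem isDomain_of_basis [IsDomain R] : IsDomain (F.FGAlgebra M) :=
  have : IsDomain (MvPowerSeries ι R) := NoZeroDivisors.to_isDomain _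
  (F.coord_injective b).isDomain _

/-- The linear coefficient is a homomorphism from the points to R, so both sides are additive in m
and can be compared on the basis. -/
theorem coeff_single_coord_x (m : M) (i : ι) :
    coeff (Finsupp.single i 1) (F.coord b (F.x m)) = (b.repr m i : R) := by
  rw [coord_x, ← ZeroPoint.linCoeff_apply]
  have : ((ZeroPoint.linCoeff F i).comp (F.point b)).toIntLinearMap =
      ((Int.castAddHom R).toIntLinearMap).comp (b.coord i) := by
    refine b.ext fun k => ?_
    classical
    have h1 : ZeroPoint.linCoeff F i (ZeroPoint.var F k) = if i = k then 1 else 0 := by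
      refine (coeff_X _ k).trans ?_
      simp [Finsupp.single_left_inj]
    simp [point_basis, h1, Finsupp.single_apply, eq_comm]
  exact LinearMap.congr_fun this m

include b in
theorem x_injective [CharZero R] : Function.Injective (F.x : M → F.FGAlgebra M) := by
  intro l m h
  refine b.ext_elem fun i => ?_
  have := F.coeff_single_coord_x b l i
  rw [h, coeff_single_coord_x] at this
  exact_mod_cast this.symm

/-- In coordinates, killing the basis element b_j is setting X_j = 0. -/
theorem x_dvd_sub_mapHom (j : ι) (e : M →+ M) (hj : e (b j) = 0)
    (he : ∀ i, i ≠ j → e (b i) = b i) (y : F.FGAlgebra M) : F.x (b j) ∣ y - F.mapHom e y := by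
  classical
  have h1 := map_dvd (F.ev b) (X_dvd_sub_subst_update j (F.coord b y))
  have h2 : F.ev b ((F.coord b y).subst (Function.update (X : ι → MvPowerSeries ι R) j 0)) =
      F.mapHom e y := by
    rw [F.ev_subst b (e ∘ b) (constantCoeff_update_X j), ← mapHom_ev, ev_coord]
    intro i
    rcases eq_or_ne i j with rfl | hij
    · rw [Function.update_self, map_zero, Function.comp_apply, hj, x_zero]
    · rw [Function.update_of_ne hij, ev_X, Function.comp_apply, he i hij]
  rwa [map_sub, h2, ev_coord, ev_X] at h1

/-- The projection along a basis element. -/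
noncomputable def basisProj {M ι : Type*} [AddCommGroup M] (b : Module.Basis ι ℤ M) (j : ι) :
    M →+ M :=
  letI := Classical.decEq ι
  (b.constr ℤ (Function.update b j 0)).toAddMonoidHom

omit [Finite ι] in
theorem basisProj_self (j : ι) : basisProj b j (b j) = 0 := by
  classical
  refine (b.constr_basis ℤ _ j).trans ?_
  simp

omit [Finite ι] in
theorem basisProj_of_ne {i j : ι} (h : i ≠ j) : basisProj b j (b i) = b i := by
  classical
  refine (b.constr_basis ℤ _ i).trans ?_
  simp [h]

/-- The quotient by x_{b_j} embeds into the algebra itself. Primality of x_{b_j} thus follows from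
the algebra being a domain, and congruences x_l ≡ x_m from the injectivity of m ↦ x_m. -/
theorem x_dvd_iff_mapHom_basisProj (j : ι) (y : F.FGAlgebra M) :
    F.x (b j) ∣ y ↔ F.mapHom (basisProj b j) y = 0 := by
  constructor
  · rintro ⟨z, rfl⟩
    rw [map_mul, mapHom_x, basisProj_self, x_zero, zero_mul]
  · intro h
    have := F.x_dvd_sub_mapHom b j _ (basisProj_self b j) (fun i hi => basisProj_of_ne b hi) y
    rwa [h, sub_zero] at this

theorem constantCoeff_coord_mul_x (j : ι) (y : F.FGAlgebra M) :
    constantCoeff (F.coord b (F.x (b j) * y)) = 0 := by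
  rw [map_mul, coord_x_basis, map_mul, constantCoeff_X, zero_mul]

theorem prime_x_basis [IsDomain R] (j : ι) : Prime (F.x (b j)) := by
  have := F.isDomain_of_basis b
  refine ⟨fun h => ?_, fun h => ?_, fun y z h => ?_⟩
  · have h1 := F.coord_x_basis b j
    rw [h, map_zero] at h1
    have h2 := congrArg (coeff (Finsupp.single j 1)) h1
    rw [map_zero, coeff_index_single_self_X] at h2
    exact one_ne_zero h2.symm
  · obtain ⟨y, hy⟩ := h.exists_right_inv
    have h1 := F.constantCoeff_coord_mul_x b j y
    rw [hy, map_one, map_one] at h1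
    exact one_ne_zero h1
  · simp only [x_dvd_iff_mapHom_basisProj, map_mul] at h ⊢
    exact mul_eq_zero.1 h

theorem not_x_basis_dvd_two [CharZero R] (j : ι) : ¬ F.x (b j) ∣ 2 := by
  rintro ⟨y, hy⟩
  have h1 := F.constantCoeff_coord_mul_x b j y
  rw [← hy, map_ofNat, map_ofNat] at h1
  exact two_ne_zero h1

theorem exists_zsmul_of_x_basis_dvd_sub [CharZero R] (j : ι) {l m : M}
    (h : F.x (b j) ∣ F.x l - F.x m) : ∃ c : ℤ, l - m = c • b j := by
  rw [x_dvd_iff_mapHom_basisProj, map_sub, mapHom_x, mapHom_x, sub_eq_zero] at h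
  have h1 : basisProj b j (l - m) = 0 := by
    rw [map_sub, F.x_injective b h, sub_self]
  have h2 : ∀ l : M, l - basisProj b j l = b.repr l j • b j := by
    intro l
    have : LinearMap.id - (basisProj b j).toIntLinearMap =
        (b.coord j).smulRight (b j) := by
      refine b.ext fun k => ?_
      rcases eq_or_ne k j with rfl | hk
      · simp [basisProj_self]
      · simp [basisProj_of_ne b hk, hk]
    exact LinearMap.congr_fun this l
  refine ⟨b.repr (l - m) j, ?_⟩
  rw [← h2, h1, sub_zero]

/-- The linear coefficient of x_{-b_j} at X_j is -1, whereas y ≡ 1 would make it 1. -/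
theorem not_x_basis_dvd_of_x_neg_eq [CharZero R] (j : ι) {y : F.FGAlgebra M}
    (h : F.x (-b j) = F.x (b j) * y) : ¬ F.x (b j) ∣ y - 1 := by
  rintro ⟨z, hz⟩
  rw [sub_eq_iff_eq_add] at hz
  have h1 := F.coeff_single_coord_x b (-b j) j
  rw [h, map_mul, coord_x_basis, ← mul_one (X j), mul_assoc, one_mul] at h1
  have h2 := coeff_add_monomial_mul (Finsupp.single j 1) 0 (F.coord b y) (1 : R)
  rw [_root_.add_zero] at h2
  have h3 : constantCoeff (F.coord b y) = 1 := by
    rw [hz, map_add, map_add, constantCoeff_coord_mul_x, map_one, map_one, _root_.zero_add]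
  rw [← X_def, h1, coeff_zero_eq_constantCoeff_apply, h3] at h2
  norm_num at h2

end FormalGroup

/-! ### The Weyl group: length and the sign of roots -/

namespace KMRootDatum

variable {n : ℕ} {A : Matrix (Fin n) (Fin n) ℤ} {h : Type*} [AddCommGroup h] [Module ℂ h]
  (D : KMRootDatum A h)

theorem s_mul_self (i : Fin n) : D.s i * D.s i = 1 := Subtype.ext (D.reflection_mul_self i)

theorem s_inv (i : Fin n) : (D.s i)⁻¹ = D.s i := inv_eq_of_mul_eq_one_left (D.s_mul_self i)

theorem mul_s_mul_s (w : D.weylGroup) (i : Fin n) : w * D.s i * D.s i = w := by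
  rw [mul_assoc, s_mul_self, mul_one]

theorem s_mul_s_mul (w : D.weylGroup) (i : Fin n) : D.s i * (D.s i * w) = w := by
  rw [← mul_assoc, s_mul_self, one_mul]

theorem wordProd_nil : D.wordProd [] = 1 := rfl

theorem wordProd_cons (i : Fin n) (I : List (Fin n)) :
    D.wordProd (i :: I) = D.s i * D.wordProd I := by
  simp [wordProd]

theorem wordProd_append (I J : List (Fin n)) :
    D.wordProd (I ++ J) = D.wordProd I * D.wordProd J := by
  simp [wordProd]

theorem wordProd_singleton (i : Fin n) : D.wordProd [i] = D.s i := by simp [wordProd]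

theorem length_wordProd_le (I : List (Fin n)) : D.length (D.wordProd I) ≤ I.length :=
  Nat.sInf_le ⟨I, rfl, rfl⟩

theorem length_mul_le (v w : D.weylGroup) : D.length (v * w) ≤ D.length v + D.length w := by
  obtain ⟨I, rfl, hI⟩ := D.exists_reducedSeq v
  obtain ⟨J, rfl, hJ⟩ := D.exists_reducedSeq w
  rw [← wordProd_append, ← hI, ← hJ, ← List.length_append]
  exact D.length_wordProd_le _

theorem length_s_le (i : Fin n) : D.length (D.s i) ≤ 1 := by
  rw [← wordProd_singleton]
  exact D.length_wordProd_le _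

theorem length_mul_s_le (w : D.weylGroup) (i : Fin n) : D.length (w * D.s i) ≤ D.length w + 1 :=
  (D.length_mul_le _ _).trans (Nat.add_le_add_left (D.length_s_le i) _)

theorem length_s_mul_le (w : D.weylGroup) (i : Fin n) : D.length (D.s i * w) ≤ D.length w + 1 := by
  have := D.length_mul_le (D.s i) w
  have := D.length_s_le i
  omega

theorem length_le_length_s_mul (w : D.weylGroup) (i : Fin n) :
    D.length w ≤ D.length (D.s i * w) + 1 := by
  have := D.length_s_mul_le (D.s i * w) i
  rwa [s_mul_s_mul] at this

theorem exists_length_mul_s_lt {w : D.weylGroup} (hw : w ≠ 1) :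
    ∃ j, D.length (w * D.s j) < D.length w := by
  obtain ⟨I, rfl, hI⟩ := D.exists_reducedSeq w
  rcases List.eq_nil_or_concat I with rfl | ⟨J, j, rfl⟩
  · exact absurd rfl hw
  · refine ⟨j, ?_⟩
    rw [← hI, List.concat_eq_append, wordProd_append, wordProd_singleton, mul_s_mul_s,
      List.length_append]
    exact Nat.lt_succ_of_le (D.length_wordProd_le J)

theorem smul_def (w : D.weylGroup) (v : Module.Dual ℂ h) :
    w • v = (w : Module.Dual ℂ h ≃ₗ[ℂ] Module.Dual ℂ h) v := rfl

theorem weyl_smul_smul (w : D.weylGroup) (c : ℂ) (v : Module.Dual ℂ h) :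
    w • c • v = c • w • v := by
  rw [smul_def, smul_def, map_smul]

theorem weyl_smul_nsmul (w : D.weylGroup) (c : ℕ) (v : Module.Dual ℂ h) :
    w • c • v = c • w • v := by
  rw [smul_def, smul_def, map_nsmul]

theorem s_smul (i : Fin n) (v : Module.Dual ℂ h) :
    D.s i • v = v - v (D.coroot i) • D.root i := D.reflection_apply i v

theorem s_smul_root (i j : Fin n) :
    D.s i • D.root j = D.root j - (A i j : ℂ) • D.root i := by
  rw [s_smul, D.pairing]

theorem s_smul_root_self (i : Fin n) : D.s i • D.root i = -D.root i := by
  rw [s_smul_root, D.isGenCartan.diag]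
  push_cast
  module

theorem root_ne_zero (i : Fin n) : D.root i ≠ 0 := D.root_indep.ne_zero i

theorem ext_smul {v w : D.weylGroup} (hvw : ∀ l : Module.Dual ℂ h, v • l = w • l) : v = w :=
  Subtype.ext (LinearEquiv.ext hvw)

/-- Non-negative integral combinations of simple roots. -/
def IsNonneg (b : Module.Dual ℂ h) : Prop := ∃ c : Fin n → ℕ, b = ∑ i, c i • D.root i

variable {D} in
theorem IsNonneg.add {b c : Module.Dual ℂ h} (hb : D.IsNonneg b) (hc : D.IsNonneg c) :
    D.IsNonneg (b + c) := by
  obtain ⟨x, rfl⟩ := hb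
  obtain ⟨y, rfl⟩ := hc
  exact ⟨x + y, by simp [add_smul, Finset.sum_add_distrib]⟩

variable {D} in
theorem IsNonneg.nsmul {b : Module.Dual ℂ h} (hb : D.IsNonneg b) (k : ℕ) :
    D.IsNonneg (k • b) := by
  obtain ⟨x, rfl⟩ := hb
  exact ⟨k • x, by simp [mul_smul, Finset.smul_sum]⟩

theorem isNonneg_root (i : Fin n) : D.IsNonneg (D.root i) := by
  classical
  exact ⟨Pi.single i 1, by simp [Pi.single_apply, ite_smul]⟩

variable {D} in
theorem IsNonneg.eq_zero_of_neg {b : Module.Dual ℂ h} (hb : D.IsNonneg b)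
    (hb' : D.IsNonneg (-b)) : b = 0 := by
  obtain ⟨x, rfl⟩ := hb
  obtain ⟨y, hy⟩ := hb'
  have h0 : ∑ i, ((x i : ℂ) + y i) • D.root i = 0 := by
    simp only [add_smul, Finset.sum_add_distrib, Nat.cast_smul_eq_nsmul]
    rw [← hy, add_neg_cancel]
  have h1 := Fintype.linearIndependent_iff.1 D.root_indep _ h0
  refine Finset.sum_eq_zero fun i _ => ?_
  have h2 : x i + y i = 0 := by exact_mod_cast h1 i
  rw [(Nat.add_eq_zero_iff.1 h2).1, zero_smul]

/-! ### Dihedral subgroups generated by two simple reflections -/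

section RankTwo

open CoxeterSystem (alternatingWord)

variable (i j : Fin n)

theorem s_smul_add_left (l : Module.Dual ℂ h) (p q : ℂ) :
    D.s i • (l + p • D.root i + q • D.root j) =
      l + (-(l (D.coroot i)) - p - A i j * q) • D.root i + q • D.root j := by
  rw [s_smul]
  simp only [LinearMap.add_apply, LinearMap.smul_apply, D.pairing, D.isGenCartan.diag,
    smul_eq_mul]
  push_cast
  module

theorem s_smul_add_right (l : Module.Dual ℂ h) (p q : ℂ) :
    D.s j • (l + p • D.root i + q • D.root j) =
      l + p • D.root i + (-(l (D.coroot j)) - q - A j i * p) • D.root j := by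
  rw [s_smul]
  simp only [LinearMap.add_apply, LinearMap.smul_apply, D.pairing, D.isGenCartan.diag,
    smul_eq_mul]
  push_cast
  module

/-- The coefficients at `α_i` and `α_j` of `⋯ s_i s_j (α_i)`, a product of `m` reflections. -/
def altCoeff (A : Matrix (Fin n) (Fin n) ℤ) (i j : Fin n) : ℕ → ℤ × ℤ
  | 0 => (1, 0)
  | m + 1 => if Even m then ((altCoeff A i j m).1, -(altCoeff A i j m).2 - A j i * (altCoeff A i j m).1)
      else (-(altCoeff A i j m).1 - A i j * (altCoeff A i j m).2, (altCoeff A i j m).2)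

/-- The product `⋯ s_i s_j` of `m` reflections. -/
noncomputable def altProd (m : ℕ) : D.weylGroup := D.wordProd (alternatingWord i j m)

theorem altProd_zero : D.altProd i j 0 = 1 := rfl

theorem altProd_succ (m : ℕ) :
    D.altProd i j (m + 1) = D.s (if Even m then j else i) * D.altProd i j m := by
  rw [altProd, CoxeterSystem.alternatingWord_succ', wordProd_cons]
  rfl

theorem length_altProd_le (m : ℕ) : D.length (D.altProd i j m) ≤ m := by
  refine (D.length_wordProd_le _).trans ?_
  rw [CoxeterSystem.length_alternatingWord]

theorem altProd_smul_root (m : ℕ) : D.altProd i j m • D.root i =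
    ((altCoeff A i j m).1 : ℂ) • D.root i + ((altCoeff A i j m).2 : ℂ) • D.root j := by
  induction m with
  | zero => simp [altProd_zero, altCoeff]
  | succ m ih =>
    rw [altProd_succ, mul_smul, ih, altCoeff, ← zero_add (((altCoeff A i j m).1 : ℂ) • D.root i)]
    split_ifs with hm
    · rw [s_smul_add_right D i j]
      push_cast
      simp
    · rw [s_smul_add_left D i j]
      push_cast
      simp

/-- The last inequality carries the induction: the coefficient about to change is at most half of
the term it is subtracted from, so it stays non-negative. The bound a_ij a_ji ≥ 4 passes the factor
two on to the other coefficient. -/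
theorem altCoeff_nonneg_of_four_le (hA : IsGenCartanMatrix A) (hij : i ≠ j)
    (h4 : 4 ≤ A i j * A j i) (m : ℕ) : 0 ≤ (altCoeff A i j m).1 ∧ 0 ≤ (altCoeff A i j m).2 ∧
      (if Even m then 2 * (altCoeff A i j m).2 ≤ -A j i * (altCoeff A i j m).1
        else 2 * (altCoeff A i j m).1 ≤ -A i j * (altCoeff A i j m).2) := by
  have ha := hA.nonpos i j hij
  have hb := hA.nonpos j i hij.symm
  induction m with
  | zero => simpa [altCoeff] using hb
  | succ m ih =>
    obtain ⟨h1, h2, h3⟩ := ih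
    rw [altCoeff]
    generalize (altCoeff A i j m).1 = p at *
    generalize (altCoeff A i j m).2 = q at *
    by_cases hm : Even m
    · have hm' : ¬ Even (m + 1) := by simpa [Nat.even_add_one] using hm
      simp only [hm, hm', if_true, if_false] at h3 ⊢
      refine ⟨h1, by linarith, ?_⟩
      nlinarith [mul_le_mul_of_nonneg_left h3 (neg_nonneg.2 ha), mul_le_mul_of_nonneg_right h4 h1]
    · have hm' : Even (m + 1) := by simpa [Nat.even_add_one] using hm
      simp only [hm, hm', if_true, if_false] at h3 ⊢
      refine ⟨by linarith, h2, ?_⟩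
      nlinarith [mul_le_mul_of_nonneg_left h3 (neg_nonneg.2 hb), mul_le_mul_of_nonneg_right h4 h2]

/-- The braid relation, with m + 1 = 2, 3, 4, 6 the order of s_i s_j. Both reflections preserve the
form l + p α_i + q α_j and act affinely on (p, q), so it is a finite computation. -/
theorem altProd_mul_s_eq_of_le_three {m : ℕ}
    (hm : (A i j = 0 ∧ A j i = 0 ∧ m = 1) ∨ (A i j = -1 ∧ A j i = -1 ∧ m = 2) ∨
      (A i j = -1 ∧ A j i = -2 ∧ m = 3) ∨ (A i j = -2 ∧ A j i = -1 ∧ m = 3) ∨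
      (A i j = -1 ∧ A j i = -3 ∧ m = 5) ∨ (A i j = -3 ∧ A j i = -1 ∧ m = 5)) :
    D.altProd i j (m + 1) * D.s i = D.altProd i j m := by
  refine D.ext_smul fun l => ?_
  suffices key : ∀ p q : ℂ, (D.altProd i j (m + 1) * D.s i) • (l + p • D.root i + q • D.root j) =
      D.altProd i j m • (l + p • D.root i + q • D.root j) by
    simpa using key 0 0
  intro p q
  have e0 : Even 0 := by decide
  have e1 : ¬ Even 1 := by decide
  have e2 : Even 2 := by decide
  have e3 : ¬ Even 3 := by decide
  have e4 : Even 4 := by decide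
  have e5 : ¬ Even 5 := by decide
  rcases hm with ⟨ha, hb, rfl⟩ | ⟨ha, hb, rfl⟩ | ⟨ha, hb, rfl⟩ | ⟨ha, hb, rfl⟩ | ⟨ha, hb, rfl⟩ |
    ⟨ha, hb, rfl⟩
  all_goals
    simp only [altProd_succ, altProd_zero, mul_one, mul_smul, e0, e1, e2, e3, e4, e5, if_true,
      if_false, s_smul_add_left D i j, s_smul_add_right D i j, ha, hb]
    refine congrArg₂ (· + ·) (congrArg (l + · • D.root i) ?_) (congrArg (· • D.root j) ?_) <;>
    · push_cast
      ring

theorem altCoeff_nonneg_of_le_three {m : ℕ}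
    (hm : (A i j = 0 ∧ A j i = 0 ∧ m = 1) ∨ (A i j = -1 ∧ A j i = -1 ∧ m = 2) ∨
      (A i j = -1 ∧ A j i = -2 ∧ m = 3) ∨ (A i j = -2 ∧ A j i = -1 ∧ m = 3) ∨
      (A i j = -1 ∧ A j i = -3 ∧ m = 5) ∨ (A i j = -3 ∧ A j i = -1 ∧ m = 5)) {k : ℕ}
    (hk : k ≤ m) : 0 ≤ (altCoeff A i j k).1 ∧ 0 ≤ (altCoeff A i j k).2 := by
  have e0 : Even 0 := by decide
  have e1 : ¬ Even 1 := by decide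
  have e2 : Even 2 := by decide
  have e3 : ¬ Even 3 := by decide
  have e4 : Even 4 := by decide
  rcases hm with ⟨ha, hb, rfl⟩ | ⟨ha, hb, rfl⟩ | ⟨ha, hb, rfl⟩ | ⟨ha, hb, rfl⟩ | ⟨ha, hb, rfl⟩ |
    ⟨ha, hb, rfl⟩
  all_goals
    interval_cases k <;> simp [altCoeff, e0, e1, e2, e3, e4, ha, hb]

theorem cartan_cases (hA : IsGenCartanMatrix A) (hij : i ≠ j) : 4 ≤ A i j * A j i ∨ ∃ m,
    (A i j = 0 ∧ A j i = 0 ∧ m = 1) ∨ (A i j = -1 ∧ A j i = -1 ∧ m = 2) ∨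
      (A i j = -1 ∧ A j i = -2 ∧ m = 3) ∨ (A i j = -2 ∧ A j i = -1 ∧ m = 3) ∨
      (A i j = -1 ∧ A j i = -3 ∧ m = 5) ∨ (A i j = -3 ∧ A j i = -1 ∧ m = 5) := by
  rw [or_iff_not_imp_left, not_le]
  intro h4
  have ha := hA.nonpos i j hij
  have hb := hA.nonpos j i hij.symm
  have h0 := hA.zero_iff i j
  generalize A i j = a at *
  generalize A j i = b at *
  rcases eq_or_ne a 0 with rfl | ha0
  · exact ⟨1, Or.inl ⟨rfl, h0.1 rfl, rfl⟩⟩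
  · have hb0 : b ≠ 0 := fun hb0 => ha0 (h0.2 hb0)
    have ha1 : a ≤ -1 := by omega
    have hb1 : b ≤ -1 := by omega
    have ha3 : -3 ≤ a := by nlinarith
    have hb3 : -3 ≤ b := by nlinarith
    interval_cases a <;> interval_cases b <;> simp at h4 ⊢

/-- For a finite dihedral group the signs are good only up to k = m. A larger k is impossible: after
moving surplus letters into v, the braid relation would make w s_i shorter than w. -/
theorem altCoeff_nonneg_of_length_le {w v : D.weylGroup} (hij : i ≠ j)
    (hw : D.length w ≤ D.length (w * D.s i)) {k : ℕ} (hwv : w = v * D.altProd i j k)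
    (hlen : D.length v + k ≤ D.length w) :
    0 ≤ (altCoeff A i j k).1 ∧ 0 ≤ (altCoeff A i j k).2 := by
  rcases cartan_cases i j D.isGenCartan hij with h4 | ⟨m, hm⟩
  · have := altCoeff_nonneg_of_four_le i j D.isGenCartan hij h4 k
    exact ⟨this.1, this.2.1⟩
  · refine altCoeff_nonneg_of_le_three i j hm ?_
    by_contra! hk
    have hdown : ∀ d, m + 1 + d = k → False := by
      intro d hd
      induction d generalizing v k with
      | zero =>
        have h1 : w * D.s i = v * D.altProd i j m := by
          rw [hwv, ← hd, add_zero, mul_assoc, altProd_mul_s_eq_of_le_three D i j hm]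
        have h2 := D.length_mul_le v (D.altProd i j m)
        have h3 := D.length_altProd_le i j m
        rw [← h1] at h2
        omega
      | succ d ih =>
        obtain rfl : k = (m + 1 + d) + 1 := by omega
        rw [altProd_succ, ← mul_assoc] at hwv
        refine ih hwv ?_ (by omega) rfl
        have := D.length_mul_s_le v (if Even (m + 1 + d) then j else i)
        omega
    exact hdown (k - (m + 1)) (by omega)

end RankTwo

/-- A Weyl group element that is not shortened by `s_i` on the right sends `α_i` to a non-negative
combination of simple roots. -/
theorem isNonneg_smul_root_of_length_le {w : D.weylGroup} {i : Fin n}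
    (hw : D.length w ≤ D.length (w * D.s i)) : D.IsNonneg (w • D.root i) := by
  induction hN : D.length w using Nat.strong_induction_on generalizing w i with
  | _ N ih =>
    rcases eq_or_ne w 1 with rfl | hw1
    · rw [one_smul]
      exact D.isNonneg_root i
    obtain ⟨j, hj⟩ := D.exists_length_mul_s_lt hw1
    have hij : i ≠ j := by
      rintro rfl
      omega
    classical
    -- Split off the longest alternating word ending in s_j with lengths adding up. The remaining v
    -- is shorter than w and shortened by neither s_i nor s_j, so induction applies to v(α_i) and
    -- v(α_j), of which w(α_i) is a non-negative combination.
    let P : ℕ → Prop := fun t => ∃ v, w = v * D.altProd i j t ∧ D.length v + t ≤ D.length w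
    have hP1 : P 1 := by
      refine ⟨w * D.s j, ?_, by omega⟩
      rw [altProd_succ, altProd_zero, mul_one, if_pos (by decide), mul_s_mul_s]
    have hPle : ∀ t, P t → t ≤ D.length w := by
      rintro t ⟨v, -, hv⟩
      omega
    have hPk := Nat.findGreatest_spec (P := P) (hPle 1 hP1) hP1
    have hk1 := Nat.le_findGreatest (P := P) (hPle 1 hP1) hP1
    have hmax : ¬ P (Nat.findGreatest P (D.length w) + 1) := fun hcon =>
      absurd (Nat.le_findGreatest (P := P) (hPle _ hcon) hcon) (by omega)
    generalize Nat.findGreatest P (D.length w) = k at hPk hk1 hmax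
    obtain ⟨v, hwv, hv⟩ := hPk
    obtain ⟨k, rfl⟩ := Nat.exists_eq_add_of_le' hk1
    have hnext : D.length v ≤ D.length (v * D.s (if Even (k + 1) then j else i)) := by
      by_contra! hlt
      refine hmax ⟨_, ?_, (by omega : D.length (v * D.s (if Even (k + 1) then j else i)) + _ ≤ _)⟩
      rw [altProd_succ, mul_assoc, s_mul_s_mul, ← hwv]
    -- This is the first letter of the alternating word; if it shortened v, absorbing it would
    -- shorten w.
    have hlast : D.length v ≤ D.length (v * D.s (if Even k then j else i)) := by
      by_contra! hlt
      have h1 : w = (v * D.s (if Even k then j else i)) * D.altProd i j k := by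
        rw [hwv, altProd_succ, mul_assoc]
      have h2 := D.length_mul_le (v * D.s (if Even k then j else i)) (D.altProd i j k)
      have h3 := D.length_altProd_le i j k
      rw [← h1] at h2
      omega
    have hboth : D.length v ≤ D.length (v * D.s i) ∧ D.length v ≤ D.length (v * D.s j) := by
      by_cases hk : Even k
      · simp only [hk, Nat.even_add_one, not_true, if_true, if_false] at hnext hlast
        exact ⟨hnext, hlast⟩
      · simp only [hk, Nat.even_add_one, not_false_iff, if_true, if_false] at hnext hlast
        exact ⟨hlast, hnext⟩
    have hvi := ih (D.length v) (by omega) hboth.1 rfl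
    have hvj := ih (D.length v) (by omega) hboth.2 rfl
    obtain ⟨hp, hq⟩ := D.altCoeff_nonneg_of_length_le i j hij hw hwv hv
    have h1 := D.altProd_smul_root i j (k + 1)
    generalize (altCoeff A i j (k + 1)).1 = p at *
    generalize (altCoeff A i j (k + 1)).2 = q at *
    lift p to ℕ using hp
    lift q to ℕ using hq
    rw [Int.cast_natCast, Int.cast_natCast, Nat.cast_smul_eq_nsmul, Nat.cast_smul_eq_nsmul] at h1
    rw [hwv, mul_smul, h1, smul_add, weyl_smul_nsmul, weyl_smul_nsmul]
    exact (hvi.nsmul p).add (hvj.nsmul q)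

theorem isNonneg_neg_smul_root_of_length_lt {w : D.weylGroup} {i : Fin n}
    (hw : D.length (w * D.s i) < D.length w) : D.IsNonneg (-(w • D.root i)) := by
  have := D.isNonneg_smul_root_of_length_le (w := w * D.s i) (i := i)
    (by rw [mul_s_mul_s]; exact hw.le)
  rwa [mul_smul, s_smul_root_self, smul_neg] at this

theorem isNonneg_or_neg (w : D.weylGroup) (i : Fin n) :
    D.IsNonneg (w • D.root i) ∨ D.IsNonneg (-(w • D.root i)) := by
  rcases Nat.lt_or_ge (D.length (w * D.s i)) (D.length w) with h | h
  · exact Or.inr (D.isNonneg_neg_smul_root_of_length_lt h)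
  · exact Or.inl (D.isNonneg_smul_root_of_length_le h)

/-- A nontrivial w is shortened by some s_j on the right, hence makes α_j negative. -/
theorem eq_one_of_forall_isNonneg {w : D.weylGroup} (hw : ∀ i, D.IsNonneg (w • D.root i)) :
    w = 1 := by
  by_contra hw1
  obtain ⟨j, hj⟩ := D.exists_length_mul_s_lt hw1
  have h0 := (hw j).eq_zero_of_neg (D.isNonneg_neg_smul_root_of_length_lt hj)
  exact D.root_ne_zero j ((smul_eq_zero_iff_eq w).1 h0)

end KMRootDatum

/-! ### Reflections in real roots and the exchange property -/

namespace KMRootDatum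

variable {n : ℕ} {A : Matrix (Fin n) (Fin n) ℤ} {h : Type*} [AddCommGroup h] [Module ℂ h]
  (D : KMRootDatum A h)

theorem coeff_ext {c d : Fin n → ℂ} (hcd : ∑ k, c k • D.root k = ∑ k, d k • D.root k) : c = d :=
  D.root_indep.fintypeLinearCombination_injective hcd

variable {D} in
theorem IsNonneg.exists_complex {b : Module.Dual ℂ h} (hb : D.IsNonneg b) :
    ∃ c : Fin n → ℕ, b = ∑ k, (c k : ℂ) • D.root k := by
  obtain ⟨c, rfl⟩ := hb
  exact ⟨c, by simp only [Nat.cast_smul_eq_nsmul]⟩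

theorem exists_int_coeff (w : D.weylGroup) (i : Fin n) :
    ∃ c : Fin n → ℤ, w • D.root i = ∑ k, (c k : ℂ) • D.root k := by
  rcases D.isNonneg_or_neg w i with hw | hw
  · obtain ⟨c, hc⟩ := hw.exists_complex
    exact ⟨fun k => c k, by simpa using hc⟩
  · obtain ⟨c, hc⟩ := hw.exists_complex
    refine ⟨fun k => -c k, ?_⟩
    rw [← neg_neg (w • D.root i), hc]
    simp

theorem smul_root_ne_zero (w : D.weylGroup) (i : Fin n) : w • D.root i ≠ 0 :=
  fun h0 => D.root_ne_zero i ((smul_eq_zero_iff_eq w).1 h0)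

/-- Both c and its inverse are coefficients of real roots, hence integers. -/
theorem eq_one_or_neg_one_of_smul_root_eq {w : D.weylGroup} {i j : Fin n} {c : ℂ}
    (hw : w • D.root i = c • D.root j) : c = 1 ∨ c = -1 := by
  classical
  obtain ⟨x, hx⟩ := D.exists_int_coeff w i
  obtain ⟨y, hy⟩ := D.exists_int_coeff w⁻¹ j
  have h1 : c = x j := by
    have h2 : ∑ k, (Pi.single j c : Fin n → ℂ) k • D.root k = ∑ k, (x k : ℂ) • D.root k := by
      rw [← hx, hw]
      simp [Pi.single_apply, ite_smul]
    have := congrFun (D.coeff_ext h2) j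
    simpa using this
  have h3 : ∑ k, (Pi.single i 1 : Fin n → ℂ) k • D.root k = ∑ k, (c * y k) • D.root k := by
    have h4 : D.root i = c • w⁻¹ • D.root j := by
      rw [← weyl_smul_smul, ← hw, inv_smul_smul]
    simp only [mul_smul]
    rw [← Finset.smul_sum, ← hy, ← h4]
    simp [Pi.single_apply, ite_smul]
  have h5 := congrFun (D.coeff_ext h3) i
  rw [Pi.single_eq_same, h1] at h5
  have h6 : x j * y i = 1 := by exact_mod_cast h5.symm
  rw [h1]
  rcases Int.eq_one_or_neg_one_of_mul_eq_one h6 with h7 | h7 <;> simp [h7]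

theorem isNonneg_of_smul_root_eq_add {w : D.weylGroup} {i j k : Fin n} (hkj : k ≠ j) {c : ℂ}
    (hw : w • D.root i = D.root k + c • D.root j) : D.IsNonneg (w • D.root i) := by
  classical
  refine (D.isNonneg_or_neg w i).resolve_right fun hneg => ?_
  obtain ⟨x, hx⟩ := hneg.exists_complex
  have h1 : ∑ l, (Pi.single k 1 + Pi.single j c : Fin n → ℂ) l • D.root l =
      ∑ l, (-(x l : ℂ)) • D.root l := by
    simp only [neg_smul, Finset.sum_neg_distrib]
    rw [← hx, neg_neg, hw]
    simp [Pi.single_apply, ite_smul, add_smul, Finset.sum_add_distrib]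
  have h2 := congrFun (D.coeff_ext h1) k
  simp only [Pi.add_apply, Pi.single_eq_same, Pi.single_eq_of_ne hkj, add_zero] at h2
  have h3 : (1 + x k : ℤ) = 0 := by
    have : ((1 + x k : ℤ) : ℂ) = 0 := by
      push_cast
      rw [h2]
      ring
    exact_mod_cast this
  omega

/-- A Weyl group element acting trivially modulo a simple root is trivial or the simple
reflection. -/
theorem eq_one_or_eq_s {w : D.weylGroup} {j : Fin n}
    (hw : ∀ k, ∃ c : ℂ, w • D.root k = D.root k + c • D.root j) : w = 1 ∨ w = D.s j := by
  -- For k ≠ j the image of α_k keeps the coefficient 1 at α_k, so it is positive; if α_j is fixed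
  -- as well, v = 1.
  have key : ∀ v : D.weylGroup, (∀ k, ∃ c : ℂ, v • D.root k = D.root k + c • D.root j) →
      v • D.root j = D.root j → v = 1 := by
    intro v hv hvj
    refine D.eq_one_of_forall_isNonneg fun k => ?_
    rcases eq_or_ne k j with rfl | hkj
    · rw [hvj]
      exact D.isNonneg_root k
    · obtain ⟨c, hc⟩ := hv k
      exact D.isNonneg_of_smul_root_eq_add hkj hc
  obtain ⟨c, hc⟩ := hw j
  have hc' : w • D.root j = (1 + c) • D.root j := by rw [hc, add_smul, one_smul]
  rcases D.eq_one_or_neg_one_of_smul_root_eq hc' with h1 | h1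
  · left
    refine key w hw ?_
    rw [hc', h1, one_smul]
  · right
    rw [h1, neg_smul, one_smul] at hc'
    have h2 : w * D.s j = 1 := by
      refine key _ (fun k => ?_) ?_
      · obtain ⟨d, hd⟩ := hw k
        refine ⟨d + A j k, ?_⟩
        rw [mul_smul, s_smul_root, smul_sub, weyl_smul_smul, hc', hd]
        module
      · rw [mul_smul, s_smul_root_self, smul_neg, hc', neg_neg]
    rw [← mul_one w, ← D.s_mul_self j, ← mul_assoc, h2, one_mul]

theorem conj_s_smul (w : D.weylGroup) (i : Fin n) (l : Module.Dual ℂ h) :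
    (w * D.s i * w⁻¹) • l = l - ((w⁻¹ • l) (D.coroot i)) • w • D.root i := by
  rw [mul_smul, mul_smul, s_smul, smul_sub, smul_inv_smul, weyl_smul_smul]

/-- No comparison of coroots is needed: w s_i w⁻¹ s_j moves every vector by a multiple of α_j, so it
is 1 or s_j, and it fixes α_j. -/
theorem conj_s_eq_s {w : D.weylGroup} {i j : Fin n}
    (hw : w • D.root i = D.root j ∨ w • D.root i = -D.root j) : w * D.s i * w⁻¹ = D.s j := by
  obtain ⟨e, he, hwe⟩ : ∃ e : ℂ, e * e = 1 ∧ w • D.root i = e • D.root j := by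
    rcases hw with hw | hw
    · exact ⟨1, by norm_num, by rw [hw, one_smul]⟩
    · exact ⟨-1, by norm_num, by rw [hw, neg_smul, one_smul]⟩
  have h1 : ∀ l : Module.Dual ℂ h, ∃ c : ℂ,
      (w * D.s i * w⁻¹ * D.s j) • l = l + c • D.root j := by
    intro l
    refine ⟨-(l (D.coroot j)) - (w⁻¹ • D.s j • l) (D.coroot i) * e, ?_⟩
    rw [mul_smul, conj_s_smul, hwe]
    generalize (w⁻¹ • D.s j • l) (D.coroot i) = t
    rw [s_smul]
    module
  have h2 : (w * D.s i * w⁻¹ * D.s j) • D.root j = D.root j := by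
    have h3 : D.root j = e • w • D.root i := by rw [hwe, smul_smul, he, one_smul]
    rw [mul_smul, s_smul_root_self, smul_neg, h3, weyl_smul_smul, mul_smul, mul_smul,
      inv_smul_smul, s_smul_root_self, smul_neg, smul_neg, neg_neg]
  rcases D.eq_one_or_eq_s fun k => h1 (D.root k) with h3 | h3
  · rw [mul_eq_one_iff_eq_inv, s_inv] at h3
    exact h3
  · rw [h3, s_smul_root_self] at h2
    have h4 : (2 : ℂ) • D.root j = 0 := by
      rw [two_smul]
      nth_rw 1 [← h2]
      exact neg_add_cancel _
    exact absurd ((smul_eq_zero.1 h4).resolve_left two_ne_zero) (D.root_ne_zero j)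

/-- The reflection in a real root is determined by the root up to sign. -/
theorem conj_s_eq_conj_s {v w : D.weylGroup} {i j : Fin n}
    (hvw : v • D.root i = w • D.root j ∨ v • D.root i = -(w • D.root j)) :
    v * D.s i * v⁻¹ = w * D.s j * w⁻¹ := by
  have h1 : (w⁻¹ * v) * D.s i * (w⁻¹ * v)⁻¹ = D.s j := by
    refine D.conj_s_eq_s ?_
    rw [mul_smul]
    rcases hvw with h | h
    · left
      rw [h, inv_smul_smul]
    · right
      rw [h, smul_neg, inv_smul_smul]
  rw [← h1]
  group

theorem eq_one_or_eq_conj_s {u w : D.weylGroup} {i : Fin n}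
    (hw : ∀ (v : D.weylGroup) (k : Fin n), ∃ c : ℂ, w • v • D.root k = v • D.root k + c • u • D.root i) :
    w = 1 ∨ w = u * D.s i * u⁻¹ := by
  have h1 : u⁻¹ * w * u = 1 ∨ u⁻¹ * w * u = D.s i := by
    refine D.eq_one_or_eq_s fun k => ?_
    obtain ⟨c, hc⟩ := hw u k
    refine ⟨c, ?_⟩
    rw [mul_smul, mul_smul, hc, smul_add, inv_smul_smul, weyl_smul_smul, inv_smul_smul]
  rcases h1 with h1 | h1
  · left
    have : w = u * (u⁻¹ * w * u) * u⁻¹ := by group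
    rw [this, h1]
    group
  · right
    rw [← h1]
    group

/-- Only the coefficient at α_i changes, so a change of sign forces the root to be a multiple of
α_i, that is α_i itself. -/
theorem s_smul_isNonneg {w : D.weylGroup} {i j : Fin n} (hw : D.IsNonneg (w • D.root j))
    (hi : w • D.root j ≠ D.root i) : D.IsNonneg (D.s i • w • D.root j) := by
  classical
  have h0 := D.isNonneg_or_neg (D.s i * w) j
  rw [mul_smul] at h0
  refine h0.resolve_right fun hneg => hi ?_
  obtain ⟨x, hx⟩ := hw.exists_complex
  obtain ⟨y, hy⟩ := hneg.exists_complex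
  have h1 : ∑ k, ((x k : ℂ) + y k) • D.root k =
      ∑ k, (Pi.single i ((w • D.root j) (D.coroot i)) : Fin n → ℂ) k • D.root k := by
    simp only [add_smul, Finset.sum_add_distrib]
    rw [← hx, ← hy, s_smul]
    simp [Pi.single_apply, ite_smul]
  have h2 : ∀ k, k ≠ i → x k = 0 := by
    intro k hk
    have := congrFun (D.coeff_ext h1) k
    rw [Pi.single_eq_of_ne hk] at this
    have h3 : x k + y k = 0 := by exact_mod_cast this
    omega
  have h4 : w • D.root j = (x i : ℂ) • D.root i := by
    rw [hx]
    refine Finset.sum_eq_single i (fun k _ hk => ?_) (fun hi => absurd (Finset.mem_univ i) hi)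
    rw [h2 k hk, Nat.cast_zero, zero_smul]
  rcases D.eq_one_or_neg_one_of_smul_root_eq h4 with h5 | h5
  · rw [h4, h5, one_smul]
  · have h6 : (x i : ℤ) = -1 := by exact_mod_cast h5
    omega

/-- If the inverse of a word makes a positive real root negative, then the root arises from a
prefix of the word. -/
theorem exists_prefix_of_isNonneg_neg (I : List (Fin n)) {w : D.weylGroup} {j : Fin n}
    (hw : D.IsNonneg (w • D.root j))
    (hI : D.IsNonneg (-((D.wordProd I)⁻¹ • w • D.root j))) :
    ∃ I₁ i I₂, I = I₁ ++ i :: I₂ ∧ w • D.root j = D.wordProd I₁ • D.root i := by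
  induction I generalizing w with
  | nil =>
    rw [wordProd_nil, inv_one, one_smul] at hI
    exact absurd (hw.eq_zero_of_neg hI) (D.smul_root_ne_zero w j)
  | cons i I ih =>
    by_cases hi : w • D.root j = D.root i
    · exact ⟨[], i, I, rfl, by rw [hi, wordProd_nil, one_smul]⟩
    · have h1 := D.s_smul_isNonneg hw hi
      rw [wordProd_cons, mul_inv_rev, s_inv, mul_smul, ← mul_smul (D.s i)] at hI
      rw [← mul_smul] at h1
      obtain ⟨I₁, k, I₂, rfl, h2⟩ := ih h1 hI
      refine ⟨i :: I₁, k, I₂, rfl, ?_⟩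
      rw [wordProd_cons, mul_smul, ← h2, ← mul_smul, ← mul_assoc, s_mul_self, one_mul]

/-- The reflection in a positive real root that does not arise from a prefix of a reduced word
increases the length. -/
theorem length_lt_length_conj_s_mul {I : List (Fin n)} {w u : D.weylGroup} {i : Fin n}
    (hI : D.IsReducedSeq I w) (hu : D.IsNonneg (u • D.root i))
    (hprefix : ¬ ∃ I₁ j I₂, I = I₁ ++ j :: I₂ ∧ u • D.root i = D.wordProd I₁ • D.root j) :
    D.length w < D.length (u * D.s i * u⁻¹ * w) := by
  set t := u * D.s i * u⁻¹ with ht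
  have htt : t * t = 1 := by
    rw [ht]
    calc _ = u * (D.s i * D.s i) * u⁻¹ := by group
      _ = 1 := by rw [s_mul_self]; group
  have htu : t • u • D.root i = -(u • D.root i) := by
    rw [ht, mul_smul, mul_smul, inv_smul_smul, s_smul_root_self, smul_neg]
  -- As α is no prefix root, w⁻¹(α) is positive, so (t w)⁻¹(α) is negative. Then α is a prefix root
  -- of a reduced word of t w, and deleting the corresponding letter gives a word for w.
  have h1 : D.IsNonneg (w⁻¹ • u • D.root i) := by
    have h0 := D.isNonneg_or_neg (w⁻¹ * u) i
    rw [mul_smul] at h0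
    refine h0.resolve_right fun hneg => hprefix ?_
    rw [← hI.1] at hneg
    exact D.exists_prefix_of_isNonneg_neg I hu hneg
  obtain ⟨J, hJ, hJl⟩ := D.exists_reducedSeq (t * w)
  have h2 : D.IsNonneg (-((D.wordProd J)⁻¹ • u • D.root i)) := by
    rw [hJ, mul_inv_rev, mul_smul, inv_eq_of_mul_eq_one_left htt, htu, smul_neg, neg_neg]
    exact h1
  obtain ⟨J₁, j, J₂, rfl, hJ'⟩ := D.exists_prefix_of_isNonneg_neg J hu h2
  have h3 : t = D.wordProd J₁ * D.s j * (D.wordProd J₁)⁻¹ := D.conj_s_eq_conj_s (Or.inl hJ')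
  have h4 : w = D.wordProd (J₁ ++ J₂) := by
    have h5 : w = t * (t * w) := by rw [← mul_assoc, htt, one_mul]
    rw [h5, ← hJ, wordProd_append, wordProd_append, wordProd_cons, h3]
    calc _ = D.wordProd J₁ * (D.s j * D.s j) * D.wordProd J₂ := by group
      _ = _ := by rw [s_mul_self, mul_one]
  have h6 := D.length_wordProd_le (J₁ ++ J₂)
  rw [← h4, List.length_append] at h6
  rw [← hJl, List.length_append, List.length_cons]
  omega

end KMRootDatum

theorem FormalGroup.mapHom_mapHom {R : Type*} [CommRing R] (F : FormalGroup R) {M N P : Type*}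
    [AddCommGroup M] [AddCommGroup N] [AddCommGroup P] (g : N →+ P) (f : M →+ N)
    (y : F.FGAlgebra M) : F.mapHom g (F.mapHom f y) = F.mapHom (g.comp f) y := by
  obtain ⟨y, rfl⟩ := F.proj_surjective M y
  rw [mapHom_proj, mapHom_proj, mapHom_proj, ← CompletedPoly.rename_comp]
  rfl

theorem smul_dvd_smul_of_dvd {G S : Type*} [Group G] [CommRing S] [MulSemiringAction G S] (g : G)
    {a b : S} (hab : a ∣ b) : g • a ∣ g • b :=
  map_dvd (MulSemiringAction.toRingHom G S g) hab

/-! ### The prime x_α and the Weyl group action modulo x_α -/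

namespace KMRootDatum.DemazureLattice

variable {n : ℕ} {A : Matrix (Fin n) (Fin n) ℤ} {h : Type*} [AddCommGroup h] [Module ℂ h]
  {D : KMRootDatum A h} (L : D.DemazureLattice)
  {R : Type*} [CommRing R] [IsDomain R] [CharZero R] (F : FormalGroup R) [F.IsComm]

theorem coe_smul (w : D.weylGroup) (l : L.carrier) :
    ((w • l : L.carrier) : Module.Dual ℂ h) = w • (l : Module.Dual ℂ h) := rfl

theorem exists_basis_eq_simpleRoot (i : Fin n) :
    ∃ (r : ℕ) (b : Module.Basis (Fin r) ℤ L.carrier) (j : Fin r), b j = L.simpleRoot i := by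
  obtain ⟨r, b, j, hj⟩ := L.extends_to_basis i
  exact ⟨r, b, j, Subtype.ext hj⟩

omit [CharZero R] in
theorem isDomain_S (i : Fin n) : IsDomain (L.S F) := by
  obtain ⟨r, b, j, hj⟩ := L.exists_basis_eq_simpleRoot i
  exact F.isDomain_of_basis b

variable (u : D.weylGroup) (i : Fin n)

omit [IsDomain R] [CharZero R] [F.IsComm] in
theorem smul_dvd_iff {a b : L.S F} (w : D.weylGroup) : w • a ∣ b ↔ a ∣ w⁻¹ • b := by
  constructor
  · intro hab
    simpa using smul_dvd_smul_of_dvd w⁻¹ hab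
  · intro hab
    simpa using smul_dvd_smul_of_dvd w hab

omit [CharZero R] in
theorem prime_x_root : Prime (F.x (u • L.simpleRoot i) : L.S F) := by
  obtain ⟨r, b, j, hj⟩ := L.exists_basis_eq_simpleRoot i
  have h1 := F.prime_x_basis b j
  rw [hj] at h1
  rw [← L.smul_x F]
  exact (MulEquiv.prime_iff (MulSemiringAction.toRingEquiv D.weylGroup (L.S F) u)).2 h1

omit [IsDomain R] [CharZero R] [F.IsComm] in
theorem smul_eq_mapHom (w : D.weylGroup) (f : L.S F) :
    w • f = F.mapHom (DistribSMul.toAddMonoidHom L.carrier w) f := rfl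

/-- s_i moves a vector by a multiple of α_i, which the projection kills. This is why s_i acts
trivially modulo x_{α_i}. -/
theorem basisProj_comp_s {r : ℕ} (b : Module.Basis (Fin r) ℤ L.carrier) (j : Fin r)
    (hj : b j = L.simpleRoot i) :
    (FormalGroup.basisProj b j).comp (DistribSMul.toAddMonoidHom L.carrier (D.s i)) =
      FormalGroup.basisProj b j := by
  ext1 l
  obtain ⟨m, hm⟩ := L.integral l l.2 (D.coroot i) (AddSubgroup.subset_closure ⟨i, rfl⟩)
  have h1 : D.s i • l = l - m • b j := by
    refine Subtype.ext ?_
    rw [coe_smul, D.s_smul, hm, hj, Int.cast_smul_eq_zsmul]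
    rfl
  rw [AddMonoidHom.comp_apply, DistribSMul.toAddMonoidHom_apply, h1, map_sub, map_zsmul,
    FormalGroup.basisProj_self, smul_zero, sub_zero]

omit [IsDomain R] [CharZero R] in
theorem x_simpleRoot_dvd_sub_s_smul (f : L.S F) :
    F.x (L.simpleRoot i) ∣ f - D.s i • f := by
  obtain ⟨r, b, j, hj⟩ := L.exists_basis_eq_simpleRoot i
  rw [← hj, F.x_dvd_iff_mapHom_basisProj, map_sub, sub_eq_zero, L.smul_eq_mapHom,
    F.mapHom_mapHom, L.basisProj_comp_s i b j hj]

omit [IsDomain R] [CharZero R] in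
/-- The reflection in a real root acts trivially modulo `x_α`. -/
theorem x_root_dvd_sub_smul (f : L.S F) :
    F.x (u • L.simpleRoot i) ∣ f - (u * D.s i * u⁻¹) • f := by
  rw [← L.smul_x F, L.smul_dvd_iff, smul_sub, mul_smul, mul_smul, inv_smul_smul]
  exact L.x_simpleRoot_dvd_sub_s_smul F i _

omit [IsDomain R] in
theorem exists_zsmul_of_x_root_dvd_sub {l m : L.carrier}
    (hlm : (F.x (u • L.simpleRoot i) : L.S F) ∣ F.x l - F.x m) :
    ∃ c : ℤ, l - m = c • u • L.simpleRoot i := by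
  obtain ⟨r, b, j, hj⟩ := L.exists_basis_eq_simpleRoot i
  rw [← L.smul_x F, L.smul_dvd_iff, smul_sub, L.smul_x, L.smul_x, ← hj] at hlm
  obtain ⟨c, hc⟩ := F.exists_zsmul_of_x_basis_dvd_sub b j hlm
  refine ⟨c, ?_⟩
  have h1 := congrArg (u • ·) hc
  simp only [smul_sub, smul_inv_smul, hj] at h1
  rw [h1]
  exact map_zsmul (DistribSMul.toAddMonoidHom L.carrier u) c _

omit [IsDomain R] in
theorem not_x_root_dvd_two : ¬ (F.x (u • L.simpleRoot i) : L.S F) ∣ 2 := by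
  obtain ⟨r, b, j, hj⟩ := L.exists_basis_eq_simpleRoot i
  have h1 := F.not_x_basis_dvd_two b j
  rw [hj] at h1
  have h2 : u⁻¹ • (2 : L.S F) = 2 :=
    map_ofNat (MulSemiringAction.toRingHom D.weylGroup (L.S F) u⁻¹) 2
  rwa [← L.smul_x F, L.smul_dvd_iff, h2]

theorem conj_s_smul_root : (u * D.s i * u⁻¹) • u • L.simpleRoot i = -(u • L.simpleRoot i) := by
  refine Subtype.ext ?_
  rw [mul_smul, mul_smul, inv_smul_smul, coe_smul, coe_smul, NegMemClass.coe_neg, coe_smul]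
  change u • D.s i • D.root i = -(u • D.root i)
  rw [D.s_smul_root_self, smul_neg]

/-- The element `x_{-α}` is a unit multiple of `x_α`, and the unit is congruent to `-1`. -/
theorem exists_x_neg_root_eq : ∃ y y' : L.S F,
    F.x (-(u • L.simpleRoot i)) = F.x (u • L.simpleRoot i) * y ∧
    F.x (u • L.simpleRoot i) = F.x (-(u • L.simpleRoot i)) * y' ∧
    F.x (u • L.simpleRoot i) ∣ y + 1 := by
  have hdom := L.isDomain_S F i
  have hprime := L.prime_x_root F u i
  have h0 := L.x_root_dvd_sub_smul F u i
  set t := u * D.s i * u⁻¹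
  have htα : t • (F.x (u • L.simpleRoot i) : L.S F) = F.x (-(u • L.simpleRoot i)) := by
    rw [L.smul_x, L.conj_s_smul_root]
  have htα' : t • (F.x (-(u • L.simpleRoot i)) : L.S F) = F.x (u • L.simpleRoot i) := by
    rw [L.smul_x, smul_neg, L.conj_s_smul_root, neg_neg]
  obtain ⟨y, hy⟩ : F.x (u • L.simpleRoot i) ∣ F.x (-(u • L.simpleRoot i)) := by
    have := h0 (F.x (u • L.simpleRoot i))
    rw [htα] at this
    exact (dvd_sub_right dvd_rfl).1 this
  have hy' : F.x (u • L.simpleRoot i) = F.x (-(u • L.simpleRoot i)) * t • y := by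
    have h1 := congrArg (t • ·) hy
    simp only [smul_mul', htα, htα'] at h1
    exact h1
  refine ⟨y, t • y, hy, hy', ?_⟩
  -- Because t is trivial modulo x_α, this gives y² ≡ 1, so y ≡ ±1 by primality; the linear
  -- coefficient of x_{-α} rules out y ≡ 1.
  have h1 : y * t • y = 1 := by
    have h2 : F.x (u • L.simpleRoot i) * (y * t • y) = F.x (u • L.simpleRoot i) * 1 := by
      rw [← mul_assoc, ← hy, ← hy', mul_one]
    exact mul_left_cancel₀ hprime.ne_zero h2
  have h3 : F.x (u • L.simpleRoot i) ∣ (y - 1) * (y + 1) := by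
    have : (y - 1) * (y + 1) = y * (y - t • y) := by linear_combination h1
    rw [this]
    exact Dvd.dvd.mul_left (h0 y) y
  refine (hprime.dvd_or_dvd h3).resolve_left fun h4 => ?_
  obtain ⟨r, b, j, hj⟩ := L.exists_basis_eq_simpleRoot i
  refine F.not_x_basis_dvd_of_x_neg_eq b j (y := u⁻¹ • y) ?_ ?_
  · have := congrArg (u⁻¹ • ·) hy
    simp only [smul_mul', L.smul_x, smul_neg, inv_smul_smul] at this
    rw [hj]
    exact this
  · rw [← L.smul_x F, L.smul_dvd_iff, smul_sub, smul_one] at h4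
    rw [hj]
    exact h4

omit [IsDomain R] in
-- Since x_0 = 0, the divisibility is a congruence x_β ≡ x_0, which puts β in ℤα; proportional real
-- roots agree up to sign.
theorem eq_or_eq_neg_of_x_root_dvd {v : D.weylGroup} {j : Fin n}
    (hv : (F.x (u • L.simpleRoot i) : L.S F) ∣ F.x (v • L.simpleRoot j)) :
    v • L.simpleRoot j = u • L.simpleRoot i ∨ v • L.simpleRoot j = -(u • L.simpleRoot i) := by
  have h1 : (F.x (u • L.simpleRoot i) : L.S F) ∣ F.x (v • L.simpleRoot j) - F.x 0 := by
    rwa [F.x_zero, sub_zero]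
  obtain ⟨c, hc⟩ := L.exists_zsmul_of_x_root_dvd_sub F u i h1
  rw [sub_zero] at hc
  have h2 : v • D.root j = (c : ℂ) • u • D.root i := by
    have := congrArg (fun l : L.carrier => (l : Module.Dual ℂ h)) hc
    rw [Int.cast_smul_eq_zsmul]
    exact this
  have h3 : (u⁻¹ * v) • D.root j = (c : ℂ) • D.root i := by
    rw [mul_smul, h2, D.weyl_smul_smul, inv_smul_smul]
  rcases D.eq_one_or_neg_one_of_smul_root_eq h3 with h4 | h4
  · left
    have : c = 1 := by exact_mod_cast h4
    rw [hc, this, one_smul]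
  · right
    have : c = -1 := by exact_mod_cast h4
    rw [hc, this, neg_smul, one_smul]

omit [IsDomain R] in
theorem conj_s_eq_of_x_root_dvd {v : D.weylGroup} {j : Fin n}
    (hv : (F.x (u • L.simpleRoot i) : L.S F) ∣ F.x (v • L.simpleRoot j)) :
    v * D.s j * v⁻¹ = u * D.s i * u⁻¹ := by
  refine D.conj_s_eq_conj_s ?_
  rcases L.eq_or_eq_neg_of_x_root_dvd F u i hv with h1 | h1
  · exact Or.inl (congrArg Subtype.val h1)
  · exact Or.inr (congrArg Subtype.val h1)

omit [IsDomain R] in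
/-- The residues of `v` and `w` modulo `x_α` are distinct unless `v` and `w` agree up to the
reflection in `α`. -/
theorem exists_not_x_root_dvd_sub {v w : D.weylGroup} (hv : v ≠ w)
    (hv' : v ≠ u * D.s i * u⁻¹ * w) :
    ∃ g : L.S F, ¬ F.x (u • L.simpleRoot i) ∣ w • g - v • g := by
  by_contra! hcon
  -- Testing on x_λ with w(λ) a real root shows that v w⁻¹ moves every real root by a multiple of α.
  have h1 : v * w⁻¹ = 1 ∨ v * w⁻¹ = u * D.s i * u⁻¹ := by
    refine D.eq_one_or_eq_conj_s fun v' k => ?_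
    have h2 := hcon (F.x (w⁻¹ • v' • L.simpleRoot k))
    rw [L.smul_x, L.smul_x] at h2
    obtain ⟨c, hc⟩ := L.exists_zsmul_of_x_root_dvd_sub F u i h2
    refine ⟨-c, ?_⟩
    have h3 := congrArg (fun l : L.carrier => (l : Module.Dual ℂ h)) hc
    have h4 : w • w⁻¹ • v' • D.root k - v • w⁻¹ • v' • D.root k = c • u • D.root i := h3
    rw [smul_inv_smul, ← Int.cast_smul_eq_zsmul ℂ] at h4
    rw [mul_smul, neg_smul, ← h4]
    abel
  rcases h1 with h1 | h1
  · exact hv (mul_inv_eq_one.1 h1)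
  · exact hv' (mul_inv_eq_iff_eq_mul.1 h1)

include L in
theorem conj_s_ne_one : u * D.s i * u⁻¹ ≠ 1 := by
  intro h1
  have h2 := congrArg (fun l : L.carrier => (l : Module.Dual ℂ h)) (L.conj_s_smul_root u i)
  simp only [h1, one_smul] at h2
  have h3 : (2 : ℂ) • u • D.root i = 0 := by
    rw [two_smul]
    exact eq_neg_iff_add_eq_zero.1 h2
  exact D.smul_root_ne_zero u i ((smul_eq_zero.1 h3).resolve_left two_ne_zero)

end KMRootDatum.DemazureLattice

/-! ### Independence of automorphisms modulo a prime -/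

/-- A form of independence of automorphisms: if `t` acts trivially modulo the prime `π`, changes the
sign of `π` to first order, and the elements of the group outside a common coset of `{1, t}` are
distinct modulo `π`, then a combination of group elements with values divisible by `π ^ 2` has
coefficients divisible by `π`, and the sums of the coefficients over cosets are divisible by
`π ^ 2`. -/
theorem Prime.dvd_coeff_of_forall_sq_dvd_sum {G S : Type*} [Group G] [CommRing S] [IsDomain S]
    [MulSemiringAction G S] {π : S} (hπ : Prime π) {t : G} (ht : t ≠ 1)
    (hfix : ∀ f, π ∣ f - t • f)
    (hsep : ∀ v w, v ≠ w → v ≠ t * w → ∃ g : S, ¬ π ∣ w • g - v • g)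
    {y : S} (hy : t • π = π * y) (hy1 : π ∣ y + 1) (h2 : ¬ π ∣ 2)
    {U : Finset G} {c : G → S} (hc : ∀ w ∉ U, c w = 0)
    (hsum : ∀ f : S, π ^ 2 ∣ ∑ w ∈ U, c w * w • f) (w₀ : G) :
    π ∣ c w₀ ∧ π ^ 2 ∣ c w₀ + c (t * w₀) := by
  classical
  have hne : w₀ ≠ t * w₀ := fun h0 => ht (right_eq_mul.1 h0)
  set U' := U ∪ {w₀, t * w₀}
  have hsum' : ∀ f : S, π ^ 2 ∣ ∑ w ∈ U', c w * w • f := fun f => by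
    rw [← Finset.sum_subset (Finset.subset_union_left (s₁ := U) (s₂ := {w₀, t * w₀}))
      (fun w _ hw => by rw [hc w hw, zero_mul])]
    exact hsum f
  have hg : ∀ v, ∃ g : S, v ≠ w₀ → v ≠ t * w₀ → ¬ π ∣ w₀ • g - v • g := fun v => by
    by_cases h0 : v ≠ w₀ ∧ v ≠ t * w₀
    · obtain ⟨g, hg⟩ := hsep v w₀ h0.1 h0.2
      exact ⟨g, fun _ _ => hg⟩
    · exact ⟨0, fun h1 h2 => (h0 ⟨h1, h2⟩).elim⟩
  choose g hg using hg
  -- Applying the hypothesis to g_v f and subtracting v(g_v) times the hypothesis for f multiplies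
  -- the coefficient at w by w(g_v) - v(g_v), which removes v. Only w₀ and t w₀ are kept.
  set e : Finset G → G → S := fun V w => ∏ v ∈ V, (w • g v - v • g v) with he
  have hmul : ∀ V : Finset G, ∀ f : S, π ^ 2 ∣ ∑ w ∈ U', c w * e V w * w • f := by
    intro V
    induction V using Finset.induction_on with
    | empty => simpa [he] using hsum'
    | insert v V hv ih =>
      intro f
      have h1 : ∑ w ∈ U', c w * e (insert v V) w * w • f =
          ∑ w ∈ U', c w * e V w * w • (g v * f) - v • g v * ∑ w ∈ U', c w * e V w * w • f := by
        rw [Finset.mul_sum, ← Finset.sum_sub_distrib]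
        refine Finset.sum_congr rfl fun w _ => ?_
        rw [he]
        simp only [Finset.prod_insert hv, smul_mul']
        ring
      rw [h1]
      exact dvd_sub (ih _) (Dvd.dvd.mul_left (ih f) _)
  set V := U' \ {w₀, t * w₀}
  have hV : ∀ v ∈ V, v ≠ w₀ ∧ v ≠ t * w₀ := fun v hv => by
    have := (Finset.mem_sdiff.1 hv).2
    simpa [not_or] using this
  have hpair : ∀ f : S,
      π ^ 2 ∣ c w₀ * e V w₀ * f + c (t * w₀) * e V (t * w₀) * t • f := fun f => by
    have h1 := hmul V (w₀⁻¹ • f)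
    rw [← Finset.sum_subset (s₁ := {w₀, t * w₀}) Finset.subset_union_right
      (fun w hw hw' => ?_), Finset.sum_pair hne, mul_smul, smul_inv_smul] at h1
    · exact h1
    · have : e V w = 0 :=
        Finset.prod_eq_zero (i := w) (Finset.mem_sdiff.2 ⟨hw, hw'⟩) (sub_self _)
      rw [this, mul_zero, zero_mul]
  have hE : ¬ π ∣ e V w₀ := fun h0 => by
    obtain ⟨v, hv, hdvd⟩ := (hπ.dvd_finsetProd_iff _).1 h0
    exact hg v (hV v hv).1 (hV v hv).2 hdvd
  have hEE : π ∣ e V w₀ - e V (t * w₀) := by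
    rw [← Ideal.mem_span_singleton, ← Ideal.Quotient.eq, map_prod, map_prod]
    refine Finset.prod_congr rfl fun v _ => ?_
    rw [Ideal.Quotient.eq, Ideal.mem_span_singleton, sub_sub_sub_cancel_right, mul_smul]
    exact hfix _
  -- f = 1 gives C E + C' E' ≡ 0 modulo π². f = π gives C E - C' E' ≡ 0 modulo π only, one factor π
  -- being cancelled and y ≡ -1. The difference 2 C' E' then yields π ∣ C'.
  have h1 := hpair 1
  rw [smul_one, mul_one, mul_one] at h1
  generalize e V w₀ = E, e V (t * w₀) = E' at *
  generalize c w₀ = C, c (t * w₀) = C' at *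
  have hE' : ¬ π ∣ E' := fun h0 => hE ((dvd_sub_left h0).1 hEE)
  have h3 : π ∣ C * E + C' * E' * y := by
    have h4 := hpair π
    rw [hy, show C * E * π + C' * E' * (π * y) = π * (C * E + C' * E' * y) by ring, sq] at h4
    exact (mul_dvd_mul_iff_left hπ.ne_zero).1 h4
  have h5 : π ∣ C * E + C' * E' := (dvd_pow_self π two_ne_zero).trans h1
  have hC' : π ∣ C' := by
    have h6 : π ∣ C' * (E' * 2) := by
      have : C' * (E' * 2) = (C * E + C' * E') - (C * E + C' * E' * y) + C' * E' * (y + 1) := by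
        ring
      rw [this]
      exact dvd_add (dvd_sub h5 h3) (Dvd.dvd.mul_left hy1 _)
    exact (hπ.dvd_or_dvd h6).resolve_right fun h7 => (hπ.dvd_or_dvd h7).elim hE' h2
  constructor
  · have h6 : π ∣ C * E := (dvd_add_left (Dvd.dvd.mul_right hC' E')).1 h5
    exact (hπ.dvd_or_dvd h6).resolve_right hE
  -- Replacing E' by E costs C'(E - E'), a product of two multiples of π.
  · have h6 : π ^ 2 ∣ (C + C') * E := by
      have : (C + C') * E = (C * E + C' * E') + C' * (E - E') := by ring
      rw [this]
      refine dvd_add h1 ?_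
      rw [sq]
      exact mul_dvd_mul hC' hEE
    exact hπ.pow_dvd_of_dvd_mul_right 2 hE h6

/-! ### Regularity along a prime -/

section LocalSubalgebra

variable {S : Type*} [CommRing S] (Q : Type*) [CommRing Q] [Algebra S Q] {π : S} (hπ : Prime π)

/-- The elements of an `S`-algebra that have a denominator in `S` prime to `π`. -/
def Prime.localSubalgebra : Subalgebra S Q where
  carrier := {q | ∃ t a : S, ¬ π ∣ t ∧ algebraMap S Q t * q = algebraMap S Q a}
  mul_mem' := by
    rintro q q' ⟨t, a, ht, h⟩ ⟨t', a', ht', h'⟩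
    refine ⟨t * t', a * a', hπ.not_dvd_mul ht ht', ?_⟩
    rw [map_mul, map_mul, ← h, ← h']
    ring
  add_mem' := by
    rintro q q' ⟨t, a, ht, h⟩ ⟨t', a', ht', h'⟩
    refine ⟨t * t', t' * a + t * a', hπ.not_dvd_mul ht ht', ?_⟩
    rw [map_mul, map_add, map_mul, map_mul, ← h, ← h']
    ring
  algebraMap_mem' a := ⟨1, a, hπ.not_dvd_one, by rw [map_one, one_mul]⟩

variable {Q}

theorem Prime.mem_localSubalgebra_of_mul_mem {t : S} (ht : ¬ π ∣ t) {q : Q}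
    (hq : algebraMap S Q t * q ∈ hπ.localSubalgebra Q) : q ∈ hπ.localSubalgebra Q := by
  obtain ⟨t', a, ht', h⟩ := hq
  refine ⟨t' * t, a, hπ.not_dvd_mul ht' ht, ?_⟩
  rw [map_mul, mul_assoc, h]

/-- The way back from Q to S: the denominator of q is prime to π, so π must divide a. -/
theorem Prime.dvd_of_algebraMap_eq_mul (hinj : Function.Injective (algebraMap S Q)) {a : S} {q : Q}
    (hq : q ∈ hπ.localSubalgebra Q) (haq : algebraMap S Q a = algebraMap S Q π * q) : π ∣ a := by
  obtain ⟨t, b, ht, h⟩ := hq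
  have h1 : t * a = π * b := hinj (by rw [map_mul, map_mul, ← h, haq]; ring)
  exact (hπ.dvd_or_dvd (Dvd.intro b h1.symm)).resolve_left ht

theorem Prime.exists_common_denominator {ι : Type*} (U : Finset ι) {q : ι → Q}
    (hq : ∀ w, q w ∈ hπ.localSubalgebra Q) :
    ∃ t : S, ¬ π ∣ t ∧ ∀ w ∈ U, ∃ a : S, algebraMap S Q t * q w = algebraMap S Q a := by
  classical
  induction U using Finset.induction_on with
  | empty => exact ⟨1, hπ.not_dvd_one, by simp⟩
  | insert v U _ ih =>
    obtain ⟨t, ht, h⟩ := ih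
    obtain ⟨t', a', ht', h'⟩ := hq v
    refine ⟨t * t', hπ.not_dvd_mul ht ht', fun w hw => ?_⟩
    rcases Finset.mem_insert.1 hw with rfl | hw
    · exact ⟨t * a', by rw [map_mul, map_mul, mul_assoc, h']⟩
    · obtain ⟨a, ha⟩ := h w hw
      exact ⟨t' * a, by rw [map_mul, map_mul, ← ha]; ring⟩

end LocalSubalgebra

/-! ### Coefficients of products of Demazure elements -/

namespace KMRootDatum.DemazureLattice

variable {n : ℕ} {A : Matrix (Fin n) (Fin n) ℤ} {h : Type*} [AddCommGroup h] [Module ℂ h]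
  {D : KMRootDatum A h} (L : D.DemazureLattice) {R : Type*} [CommRing R] (F : FormalGroup R)

section Coefficients

theorem algebraMap_x_mul_smul_invX (w : D.weylGroup) (i : Fin n) :
    algebraMap (L.S F) (L.Q F) (F.x (w • L.simpleRoot i)) * w • L.invX F i = 1 := by
  have h1 : algebraMap (L.S F) (L.Q F) (F.x (L.simpleRoot i)) * L.invX F i = 1 :=
    (IsLocalization.mk'_spec' (L.Q F) 1
      (⟨F.x (L.simpleRoot i), L.x_simpleRoot_mem F i⟩ : L.rootMonoid F)).trans (map_one _)
  rw [← L.smul_x F, ← L.smul_algebraMap, ← smul_mul', h1, smul_one]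

theorem demazure_eq_sub (i : Fin n) : L.demazure F i =
    SkewMonoidAlgebra.single 1 (L.invX F i) - SkewMonoidAlgebra.single (D.s i) (L.invX F i) := by
  rw [demazure, delta, SkewMonoidAlgebra.one_def, smul_sub, SkewMonoidAlgebra.smul_single,
    SkewMonoidAlgebra.smul_single, smul_eq_mul, mul_one]

theorem coeff_demazure_mul (i : Fin n) (z : L.QW F) (w : D.weylGroup) :
    (L.demazure F i * z).coeff w =
      L.invX F i * (z.coeff w - D.s i • z.coeff (D.s i * w)) := by
  rw [demazure_eq_sub, sub_mul, SkewMonoidAlgebra.coeff_sub, Finsupp.sub_apply,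
    SkewMonoidAlgebra.coeff_single_mul, SkewMonoidAlgebra.coeff_single_mul, inv_one, one_mul,
    one_smul, D.s_inv, mul_sub]

theorem coeff_mul_demazure (i : Fin n) (z : L.QW F) (w : D.weylGroup) :
    (z * L.demazure F i).coeff w =
      z.coeff w * w • L.invX F i - z.coeff (w * D.s i) * (w * D.s i) • L.invX F i := by
  rw [demazure_eq_sub, mul_sub, SkewMonoidAlgebra.coeff_sub, Finsupp.sub_apply,
    SkewMonoidAlgebra.coeff_mul_single, SkewMonoidAlgebra.coeff_mul_single, inv_one, mul_one,
    D.s_inv]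

theorem demazureProd_nil : L.demazureProd F [] = 1 := rfl

theorem demazureProd_cons (i : Fin n) (I : List (Fin n)) :
    L.demazureProd F (i :: I) = L.demazure F i * L.demazureProd F I := by
  simp [demazureProd]

theorem demazureProd_append_singleton (i : Fin n) (I : List (Fin n)) :
    L.demazureProd F (I ++ [i]) = L.demazureProd F I * L.demazure F i := by
  simp [demazureProd]

/-- The product `X_I` has no component at the elements, other than `s_{i_1} ⋯ s_{i_l}`, of length at
least `l`. -/
theorem coeff_demazureProd_eq_zero (I : List (Fin n)) {v : D.weylGroup}
    (hv : I.length ≤ D.length v) (hne : v ≠ D.wordProd I) :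
    (L.demazureProd F I).coeff v = 0 := by
  induction I generalizing v with
  | nil =>
    rw [demazureProd_nil, SkewMonoidAlgebra.coeff_one]
    exact Finsupp.single_eq_of_ne hne
  | cons i I ih =>
    rw [List.length_cons] at hv
    have h1 := D.length_le_length_s_mul v i
    have h2 := D.length_wordProd_le I
    rw [demazureProd_cons, coeff_demazure_mul, ih (by omega), ih (by omega), smul_zero, sub_zero,
      mul_zero]
    · rintro h3
      refine hne ?_
      rw [D.wordProd_cons, ← h3, D.s_mul_s_mul]
    · rintro rfl
      omega

/-- The product of the `x_β` over the roots `β = s_{i_1} ⋯ s_{i_{m-1}} (α_{i_m})` of a sequence. -/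
noncomputable def prefixRootProd : List (Fin n) → L.S F
  | [] => 1
  | i :: I => F.x (L.simpleRoot i) * D.s i • prefixRootProd I

theorem x_dvd_prefixRootProd (I₁ : List (Fin n)) (j : Fin n) (I₂ : List (Fin n)) :
    F.x (D.wordProd I₁ • L.simpleRoot j) ∣ L.prefixRootProd F (I₁ ++ j :: I₂) := by
  induction I₁ with
  | nil =>
    rw [D.wordProd_nil, one_smul]
    exact Dvd.intro _ rfl
  | cons i I₁ ih =>
    rw [D.wordProd_cons, mul_smul, ← L.smul_x F]
    exact Dvd.dvd.mul_left (smul_dvd_smul_of_dvd (D.s i) ih) _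

/-- For a reduced word, the full product is reached only by taking -x_{α_i}⁻¹ δ_{s_i} from every
factor; moving the δ's to the right turns the denominators into the x_β of the prefix roots. -/
theorem prefixRootProd_mul_coeff (I : List (Fin n)) (hI : D.length (D.wordProd I) = I.length) :
    algebraMap (L.S F) (L.Q F) (L.prefixRootProd F I) *
      (L.demazureProd F I).coeff (D.wordProd I) = (-1) ^ I.length := by
  induction I with
  | nil =>
    rw [demazureProd_nil, SkewMonoidAlgebra.coeff_one, D.wordProd_nil, Finsupp.single_eq_same,
      prefixRootProd, map_one, mul_one, List.length_nil, pow_zero]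
  | cons i I ih =>
    have h1 := D.length_wordProd_le I
    have h2 := D.length_s_mul_le (D.wordProd I) i
    rw [← D.wordProd_cons, hI, List.length_cons] at h2
    have h3 : (L.demazureProd F I).coeff (D.wordProd (i :: I)) = 0 := by
      refine L.coeff_demazureProd_eq_zero F I ?_ ?_
      · rw [hI, List.length_cons]
        omega
      · intro h0
        rw [h0, List.length_cons] at hI
        omega
    have h4 := congrArg (D.s i • ·) (ih (by omega))
    simp only [smul_mul', L.smul_algebraMap, smul_pow', smul_neg, smul_one] at h4
    have h5 := L.algebraMap_x_mul_smul_invX F 1 i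
    rw [one_smul, one_smul] at h5
    rw [demazureProd_cons, coeff_demazure_mul, h3, D.wordProd_cons, D.s_mul_s_mul, zero_sub,
      prefixRootProd, map_mul, List.length_cons, pow_succ, ← h4]
    linear_combination (-(algebraMap (L.S F) (L.Q F) (D.s i • L.prefixRootProd F I)) *
      D.s i • (L.demazureProd F I).coeff (D.wordProd I)) * h5

end Coefficients

end KMRootDatum.DemazureLattice

theorem SkewMonoidAlgebra.coeff_finsetSum {k G ι : Type*} [AddCommMonoid k] (U : Finset ι)
    (f : ι → SkewMonoidAlgebra k G) : (∑ x ∈ U, f x).coeff = ∑ x ∈ U, (f x).coeff :=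
  _root_.map_sum SkewMonoidAlgebra.coeffAddEquiv f U

/-! ### Elements with cancelling simple poles along x_α -/

namespace KMRootDatum.DemazureLattice

variable {n : ℕ} {A : Matrix (Fin n) (Fin n) ℤ} {h : Type*} [AddCommGroup h] [Module ℂ h]
  {D : KMRootDatum A h} (L : D.DemazureLattice)
  {R : Type*} [CommRing R] [IsDomain R] [CharZero R] (F : FormalGroup R) [F.IsComm]
  (u : D.weylGroup) (i : Fin n)

/-- The elements of `Q` with a denominator prime to `x_α`, for the real root `α = u(α_i)`. -/
noncomputable def rootLocalSubalgebra : Subalgebra (L.S F) (L.Q F) :=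
  (L.prime_x_root F u i).localSubalgebra (L.Q F)

omit [CharZero R] in
theorem algebraMap_Q_injective (i : Fin n) : Function.Injective (algebraMap (L.S F) (L.Q F)) := by
  have hdom := L.isDomain_S F i
  refine IsLocalization.injective (L.Q F) (M := L.rootMonoid F) (Submonoid.closure_le.2 ?_)
  rintro _ ⟨b, ⟨v, j, hb⟩, rfl⟩
  have h1 : b = v • L.simpleRoot j := Subtype.ext hb
  rw [h1]
  exact mem_nonZeroDivisors_of_ne_zero (L.prime_x_root F v j).ne_zero

variable {i} {u}

omit [CharZero R] in
theorem smul_invX_mem {w : D.weylGroup} {j : Fin n}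
    (hw : ¬ (F.x (u • L.simpleRoot i) : L.S F) ∣ F.x (w • L.simpleRoot j)) :
    w • L.invX F j ∈ L.rootLocalSubalgebra F u i := by
  refine (L.prime_x_root F u i).mem_localSubalgebra_of_mul_mem hw ?_
  rw [L.algebraMap_x_mul_smul_invX F w j]
  exact one_mem _

theorem mul_s_smul_simpleRoot (w : D.weylGroup) (j : Fin n) :
    (w * D.s j) • L.simpleRoot j = -(w • L.simpleRoot j) := by
  rw [← L.conj_s_smul_root, ← mul_smul, inv_mul_cancel_right]

theorem x_root_dvd_x_of_dvd_x_neg {w : D.weylGroup} {j : Fin n}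
    (hv : F.x (u • L.simpleRoot i) ∣ (F.x (-(w • L.simpleRoot j)) : L.S F)) :
    F.x (u • L.simpleRoot i) ∣ (F.x (w • L.simpleRoot j) : L.S F) := by
  obtain ⟨_, y', -, hy', -⟩ := L.exists_x_neg_root_eq F w j
  rw [hy']
  exact Dvd.dvd.mul_right hv y'

omit [IsDomain R] [CharZero R] in
theorem x_root_dvd_x_conj_s_mul_iff (w : D.weylGroup) (j : Fin n) :
    F.x (u • L.simpleRoot i) ∣ (F.x ((u * D.s i * u⁻¹ * w) • L.simpleRoot j) : L.S F) ↔
      F.x (u • L.simpleRoot i) ∣ (F.x (w • L.simpleRoot j) : L.S F) := by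
  have h1 := L.x_root_dvd_sub_smul F u i (F.x (w • L.simpleRoot j))
  rw [L.smul_x, ← mul_smul] at h1
  exact (dvd_iff_dvd_of_dvd_sub h1).symm

omit [CharZero R] in
-- Here a = 1/x_α and b = 1/(x_α y), the model of 1/x_{-α}. Their sum (y + 1)/(x_α y) is regular
-- since y ≡ -1.
theorem mem_of_x_mul_eq_one {y : L.S F} (hy : F.x (u • L.simpleRoot i) ∣ y + 1) {a b : L.Q F}
    (ha : algebraMap (L.S F) (L.Q F) (F.x (u • L.simpleRoot i)) * a = 1)
    (hb : algebraMap (L.S F) (L.Q F) (F.x (u • L.simpleRoot i) * y) * b = 1) :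
    algebraMap (L.S F) (L.Q F) (F.x (u • L.simpleRoot i)) * a ∈ L.rootLocalSubalgebra F u i ∧
    algebraMap (L.S F) (L.Q F) (F.x (u • L.simpleRoot i)) * b ∈ L.rootLocalSubalgebra F u i ∧
    a + b ∈ L.rootLocalSubalgebra F u i := by
  have hprime := L.prime_x_root F u i
  have hy0 : ¬ F.x (u • L.simpleRoot i) ∣ y := fun h0 =>
    hprime.not_dvd_one ((dvd_add_right h0).1 hy)
  obtain ⟨d, hd⟩ := hy
  rw [map_mul] at hb
  refine ⟨by rw [ha]; exact one_mem _, hprime.mem_localSubalgebra_of_mul_mem hy0 ?_,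
    hprime.mem_localSubalgebra_of_mul_mem hy0 ?_⟩
  · rw [← mul_assoc, mul_comm (algebraMap _ _ y), hb]
    exact one_mem _
  · have h1 := congrArg (algebraMap (L.S F) (L.Q F)) hd
    rw [map_add, map_mul, map_one] at h1
    have h2 : algebraMap (L.S F) (L.Q F) y * (a + b) = algebraMap (L.S F) (L.Q F) d := by
      linear_combination a * h1 + (algebraMap (L.S F) (L.Q F) d -
        algebraMap (L.S F) (L.Q F) y * b) * ha + a * hb
    rw [h2]
    exact Subalgebra.algebraMap_mem _ _

theorem mul_smul_invX_mem {w : D.weylGroup} {j : Fin n}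
    (hw : (F.x (u • L.simpleRoot i) : L.S F) ∣ F.x (w • L.simpleRoot j)) :
    algebraMap (L.S F) (L.Q F) (F.x (u • L.simpleRoot i)) * w • L.invX F j ∈
      L.rootLocalSubalgebra F u i ∧
    w • L.invX F j + (w * D.s j) • L.invX F j ∈ L.rootLocalSubalgebra F u i := by
  obtain ⟨y, -, hy, -, hy1⟩ := L.exists_x_neg_root_eq F u i
  have ha := L.algebraMap_x_mul_smul_invX F w j
  have hb := L.algebraMap_x_mul_smul_invX F (w * D.s j) j
  rw [L.mul_s_smul_simpleRoot] at hb
  rcases L.eq_or_eq_neg_of_x_root_dvd F u i hw with h1 | h1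
  · rw [h1] at ha hb
    rw [hy] at hb
    have h2 := L.mem_of_x_mul_eq_one F hy1 ha hb
    exact ⟨h2.1, h2.2.2⟩
  · rw [h1] at ha hb
    rw [neg_neg] at hb
    rw [hy] at ha
    have h2 := L.mem_of_x_mul_eq_one F hy1 hb ha
    exact ⟨h2.2.1, by rw [add_comm]; exact h2.2.2⟩

variable (u i)

/-- The elements of `Q_W` with at most simple poles along `x_α` whose residues at `w` and `s_α w`
cancel. -/
noncomputable def cancellingPoles : AddSubgroup (L.QW F) where
  carrier := {z | ∀ w, algebraMap (L.S F) (L.Q F) (F.x (u • L.simpleRoot i)) * z.coeff w ∈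
      L.rootLocalSubalgebra F u i ∧
    z.coeff w + z.coeff (u * D.s i * u⁻¹ * w) ∈ L.rootLocalSubalgebra F u i}
  zero_mem' w := by
    simp only [SkewMonoidAlgebra.coeff_zero, Finsupp.coe_zero, Pi.zero_apply, mul_zero, add_zero]
    exact ⟨zero_mem _, zero_mem _⟩
  add_mem' {z z'} hz hz' w := by
    rw [SkewMonoidAlgebra.coeff_add, Finsupp.add_apply, Finsupp.add_apply, mul_add,
      add_add_add_comm]
    exact ⟨add_mem (hz w).1 (hz' w).1, add_mem (hz w).2 (hz' w).2⟩
  neg_mem' {z} hz w := by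
    rw [SkewMonoidAlgebra.coeff_neg, Finsupp.neg_apply, Finsupp.neg_apply, mul_neg, ← neg_add]
    exact ⟨neg_mem (hz w).1, neg_mem (hz w).2⟩

variable {u i}

omit [CharZero R] in
theorem smul_mem_cancellingPoles {q : L.Q F} (hq : q ∈ L.rootLocalSubalgebra F u i) {z : L.QW F}
    (hz : z ∈ L.cancellingPoles F u i) : q • z ∈ L.cancellingPoles F u i := by
  intro w
  rw [SkewMonoidAlgebra.coeff_smul, Finsupp.smul_apply, Finsupp.smul_apply, smul_eq_mul,
    smul_eq_mul, mul_left_comm, ← mul_add]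
  exact ⟨mul_mem hq (hz w).1, mul_mem hq (hz w).2⟩

omit [CharZero R] in
theorem one_mem_cancellingPoles : (1 : L.QW F) ∈ L.cancellingPoles F u i := by
  classical
  have h1 : ∀ w, (1 : L.QW F).coeff w ∈ L.rootLocalSubalgebra F u i := fun w => by
    rw [SkewMonoidAlgebra.coeff_one, Finsupp.single_apply]
    split_ifs
    exacts [one_mem _, zero_mem _]
  exact fun w => ⟨mul_mem (Subalgebra.algebraMap_mem _ _) (h1 _), add_mem (h1 _) (h1 _)⟩

/-- If w(α_j) = ±α, then w s_j = s_α w: the new coefficients at w and s_α w are opposite, and they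
have no double pole because the residues of z and those of 1/x_{±α} both cancel. Otherwise the
factor w(1/x_{α_j}) is regular and congruent to its s_α-translate, so each of the two terms keeps
both conditions. -/
theorem mul_demazure_mem_cancellingPoles {z : L.QW F} (hz : z ∈ L.cancellingPoles F u i)
    (j : Fin n) : z * L.demazure F j ∈ L.cancellingPoles F u i := by
  set t := u * D.s i * u⁻¹ with ht
  set ϖ := algebraMap (L.S F) (L.Q F) (F.x (u • L.simpleRoot i)) with hϖ
  have hϖO : ϖ ∈ L.rootLocalSubalgebra F u i := Subalgebra.algebraMap_mem _ _
  intro w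
  rw [coeff_mul_demazure, coeff_mul_demazure, ← ht, ← hϖ]
  by_cases hw : (F.x (u • L.simpleRoot i) : L.S F) ∣ F.x (w • L.simpleRoot j)
  · obtain ⟨h1, h2⟩ := L.mul_smul_invX_mem F hw
    have h3 : w * D.s j = t * w := by
      rw [ht, ← L.conj_s_eq_of_x_root_dvd F u i hw, inv_mul_cancel_right]
    have h4 : t * w * D.s j = w := by
      rw [← h3, D.mul_s_mul_s]
    rw [h4, h3]
    rw [h3] at h2
    constructor
    · have h5 : ϖ * (z.coeff w * w • L.invX F j - z.coeff (t * w) * (t * w) • L.invX F j) =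
          (z.coeff w + z.coeff (t * w)) * (ϖ * w • L.invX F j) -
            ϖ * z.coeff (t * w) * (w • L.invX F j + (t * w) • L.invX F j) := by ring
      rw [h5]
      exact sub_mem (mul_mem (hz w).2 h1) (mul_mem (hz _).1 h2)
    · have h5 : ∀ a b : L.Q F, a - b + (b - a) = 0 := fun a b => by ring
      rw [h5]
      exact zero_mem _
  · have key : ∀ v, ¬ (F.x (u • L.simpleRoot i) : L.S F) ∣ F.x (v • L.simpleRoot j) →
        ϖ * (z.coeff v * v • L.invX F j) ∈ L.rootLocalSubalgebra F u i ∧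
        z.coeff v * v • L.invX F j + z.coeff (t * v) * (t * v) • L.invX F j ∈
          L.rootLocalSubalgebra F u i := by
      intro v hv
      have hv' := hv
      rw [← x_root_dvd_x_conj_s_mul_iff] at hv'
      have h1 := L.smul_invX_mem F hv
      have h2 := L.smul_invX_mem F hv'
      have h3 := L.algebraMap_x_mul_smul_invX F v j
      have h4 := L.algebraMap_x_mul_smul_invX F (t * v) j
      obtain ⟨d, hd⟩ := L.x_root_dvd_sub_smul F u i (F.x (v • L.simpleRoot j))
      rw [L.smul_x, ← mul_smul, ← ht] at hd
      have h5 := congrArg (algebraMap (L.S F) (L.Q F)) hd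
      rw [map_sub, map_mul, ← hϖ] at h5
      refine ⟨?_, ?_⟩
      · rw [← mul_assoc]
        exact mul_mem (hz v).1 h1
      · have h6 : z.coeff v * v • L.invX F j + z.coeff (t * v) * (t * v) • L.invX F j =
            (z.coeff v + z.coeff (t * v)) * v • L.invX F j + ϖ * z.coeff (t * v) *
              (algebraMap (L.S F) (L.Q F) d * v • L.invX F j * (t * v) • L.invX F j) := by
          linear_combination (z.coeff (t * v) * v • L.invX F j * (t * v) • L.invX F j) * h5 -
            (z.coeff (t * v) * (t * v) • L.invX F j) * h3 +
            (z.coeff (t * v) * v • L.invX F j) * h4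
        rw [h6]
        exact add_mem (mul_mem (hz v).2 h1)
          (mul_mem (hz _).1 (mul_mem (mul_mem (Subalgebra.algebraMap_mem _ _) h1) h2))
    have hws : ¬ (F.x (u • L.simpleRoot i) : L.S F) ∣ F.x ((w * D.s j) • L.simpleRoot j) := by
      rw [L.mul_s_smul_simpleRoot]
      exact fun h0 => hw (L.x_root_dvd_x_of_dvd_x_neg F h0)
    obtain ⟨h1, h2⟩ := key w hw
    obtain ⟨h3, h4⟩ := key _ hws
    refine ⟨by rw [mul_sub]; exact sub_mem h1 h3, ?_⟩
    rw [sub_add_sub_comm, mul_assoc t w]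
    exact sub_mem h2 h4

theorem demazureProd_mem_cancellingPoles (I : List (Fin n)) :
    L.demazureProd F I ∈ L.cancellingPoles F u i := by
  induction I using List.reverseRecOn with
  | nil => exact L.one_mem_cancellingPoles F
  | append_singleton I j ih =>
    rw [demazureProd_append_singleton]
    exact L.mul_demazure_mem_cancellingPoles F ih j

/-- If the values on `S` of an element of `Q_W` with at most simple poles along `x_α` are divisible
by `x_α`, then the element is divisible by `x_α` up to elements with cancelling poles. -/
theorem smul_invX_smul_mem_cancellingPoles {z : L.QW F} (hz : z ∈ L.cancellingPoles F u i)
    (hzS : ∀ f : L.S F, ∃ g : L.S F, L.act F z (algebraMap (L.S F) (L.Q F) f) =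
      algebraMap (L.S F) (L.Q F) (F.x (u • L.simpleRoot i) * g)) :
    (u • L.invX F i) • z ∈ L.cancellingPoles F u i := by
  have hdom := L.isDomain_S F i
  have hprime := L.prime_x_root F u i
  have hinj := L.algebraMap_Q_injective F i
  have hinv := L.algebraMap_x_mul_smul_invX F u i
  obtain ⟨y, -, hy, -, hy1⟩ := L.exists_x_neg_root_eq F u i
  have htα : (u * D.s i * u⁻¹) • (F.x (u • L.simpleRoot i) : L.S F) =
      F.x (u • L.simpleRoot i) * y := by
    rw [L.smul_x, L.conj_s_smul_root, hy]
  set ϖ := algebraMap (L.S F) (L.Q F) (F.x (u • L.simpleRoot i)) with hϖ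
  obtain ⟨T, hT, ha⟩ := hprime.exists_common_denominator z.support
    (q := fun w => ϖ * z.coeff w) fun w => (hz w).1
  have ha' : ∀ w, ∃ a : L.S F, algebraMap (L.S F) (L.Q F) T * (ϖ * z.coeff w) =
      algebraMap (L.S F) (L.Q F) a := fun w => by
    by_cases hw : w ∈ z.support
    · exact ha w hw
    · exact ⟨0, by rw [SkewMonoidAlgebra.notMem_support_iff.1 hw, mul_zero, mul_zero, map_zero]⟩
  choose c hc using ha'
  have hc0 : ∀ w ∉ z.support, c w = 0 := fun w hw => hinj (by
    rw [← hc, SkewMonoidAlgebra.notMem_support_iff.1 hw, mul_zero, mul_zero, map_zero])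
  -- The numerators are c_w = T x_α z_w; the x_α that clears the poles raises the divisibility of
  -- the values to x_α².
  have hsum : ∀ f : L.S F, F.x (u • L.simpleRoot i) ^ 2 ∣ ∑ w ∈ z.support, c w * w • f := by
    intro f
    obtain ⟨g, hg⟩ := hzS f
    refine ⟨T * g, hinj ?_⟩
    rw [act, SkewMonoidAlgebra.sum_def'] at hg
    rw [map_sum, map_mul, map_pow, map_mul, ← hϖ]
    calc ∑ w ∈ z.support, algebraMap (L.S F) (L.Q F) (c w * w • f)
        = algebraMap (L.S F) (L.Q F) T * ϖ * ∑ w ∈ z.support,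
            z.coeff w * w • algebraMap (L.S F) (L.Q F) f := by
          rw [Finset.mul_sum]
          refine Finset.sum_congr rfl fun w _ => ?_
          rw [map_mul, ← hc, L.smul_algebraMap]
          ring
      _ = _ := by
          rw [hg, map_mul, ← hϖ]
          ring
  have key := hprime.dvd_coeff_of_forall_sq_dvd_sum (L.conj_s_ne_one u i)
    (L.x_root_dvd_sub_smul F u i) (fun v w hv hv' => L.exists_not_x_root_dvd_sub F u i hv hv')
    htα hy1 (L.not_x_root_dvd_two F u i) hc0 hsum
  intro w
  rw [SkewMonoidAlgebra.coeff_smul, Finsupp.smul_apply, Finsupp.smul_apply, smul_eq_mul,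
    smul_eq_mul, ← hϖ]
  obtain ⟨⟨a, ha⟩, ⟨b, hb⟩⟩ := key w
  constructor
  · refine hprime.mem_localSubalgebra_of_mul_mem hT ⟨1, a, hprime.not_dvd_one, ?_⟩
    have h1 := hc w
    rw [ha, map_mul, ← hϖ] at h1
    rw [map_one]
    linear_combination (u • L.invX F i) * h1 + algebraMap (L.S F) (L.Q F) a * hinv
  · refine hprime.mem_localSubalgebra_of_mul_mem hT ⟨1, b, hprime.not_dvd_one, ?_⟩
    have h1 := congrArg (algebraMap (L.S F) (L.Q F)) hb
    rw [map_add, ← hc, ← hc, map_mul (algebraMap (L.S F) (L.Q F)), map_pow, ← hϖ] at h1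
    rw [map_one]
    linear_combination (u • L.invX F i) ^ 2 * h1 +
      (algebraMap (L.S F) (L.Q F) b * (1 + ϖ * u • L.invX F i) -
        algebraMap (L.S F) (L.Q F) T * u • L.invX F i *
          (z.coeff w + z.coeff (u * D.s i * u⁻¹ * w))) * hinv

end KMRootDatum.DemazureLattice

/-! ### Reading off the coefficients by descending length -/

namespace KMRootDatum.DemazureLattice

variable {n : ℕ} {A : Matrix (Fin n) (Fin n) ℤ} {h : Type*} [AddCommGroup h] [Module ℂ h]
  {D : KMRootDatum A h} (L : D.DemazureLattice)
  {R : Type*} [CommRing R] [IsDomain R] [CharZero R] (F : FormalGroup R) [F.IsComm]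
  {u : D.weylGroup} {i : Fin n}

omit [CharZero R] in
/-- The coefficient of an element of maximal length in a combination of the `X_I` divisible by `x_α`
modulo elements with cancelling poles is divisible by `x_α`. -/
theorem x_root_dvd_of_smul_mem_cancellingPoles (hu : D.IsNonneg (u • D.root i)) {I : List (Fin n)}
    {w : D.weylGroup} (hI : D.IsReducedSeq I w) {c : L.S F} {z y : L.QW F}
    (hz : z = algebraMap (L.S F) (L.Q F) c • L.demazureProd F I + y)
    (hy : ∀ v, v = w ∨ D.length w < D.length v → y.coeff v = 0)
    (hzM : (u • L.invX F i) • z ∈ L.cancellingPoles F u i) :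
    F.x (u • L.simpleRoot i) ∣ c := by
  have hprime := L.prime_x_root F u i
  have hinj := L.algebraMap_Q_injective F i
  have hinv := L.algebraMap_x_mul_smul_invX F u i
  obtain ⟨rfl, hlen⟩ := hI
  have hlead := L.prefixRootProd_mul_coeff F I hlen.symm
  have hzw : z.coeff (D.wordProd I) =
      algebraMap (L.S F) (L.Q F) c * (L.demazureProd F I).coeff (D.wordProd I) := by
    rw [hz, SkewMonoidAlgebra.coeff_add, Finsupp.add_apply, SkewMonoidAlgebra.coeff_smul,
      Finsupp.smul_apply, hy _ (Or.inl rfl), add_zero, smul_eq_mul]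
  have hmul : algebraMap (L.S F) (L.Q F) (c * (-1) ^ I.length) =
      algebraMap (L.S F) (L.Q F) (L.prefixRootProd F I) * z.coeff (D.wordProd I) := by
    rw [hzw, map_mul, map_pow, map_neg, map_one, ← hlead]
    ring
  have hM := hzM (D.wordProd I)
  rw [SkewMonoidAlgebra.coeff_smul, Finsupp.smul_apply, Finsupp.smul_apply, smul_eq_mul,
    smul_eq_mul, ← mul_assoc, hinv, one_mul] at hM
  refine ((isUnit_one.neg.pow I.length).dvd_mul_right).1 ?_
  -- If α is a prefix root, the simple pole condition on x_α⁻¹ z makes z_w regular, and the factor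
  -- x_α of the prefix product must divide c.
  by_cases hprefix : ∃ I₁ j I₂, I = I₁ ++ j :: I₂ ∧ u • D.root i = D.wordProd I₁ • D.root j
  · obtain ⟨I₁, j, I₂, h1, h2⟩ := hprefix
    obtain ⟨d, hd⟩ := L.x_dvd_prefixRootProd F I₁ j I₂
    have h3 : D.wordProd I₁ • L.simpleRoot j = u • L.simpleRoot i := Subtype.ext h2.symm
    rw [← h1, h3] at hd
    refine hprime.dvd_of_algebraMap_eq_mul hinj
      (mul_mem (Subalgebra.algebraMap_mem _ d) hM.1) ?_
    rw [hmul, hd, map_mul]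
    ring
  -- Otherwise s_α w is longer than w and carries no coefficient, so the cancellation condition
  -- makes x_α⁻¹ z_w itself regular.
  · have hlt := D.length_lt_length_conj_s_mul ⟨rfl, hlen⟩ hu hprefix
    have hzt : z.coeff (u * D.s i * u⁻¹ * D.wordProd I) = 0 := by
      rw [hz, SkewMonoidAlgebra.coeff_add, Finsupp.add_apply, SkewMonoidAlgebra.coeff_smul,
        Finsupp.smul_apply, hy _ (Or.inr hlt),
        L.coeff_demazureProd_eq_zero F I (hlen.trans_le hlt.le) fun h0 => hlt.ne (by rw [h0]),
        smul_zero, add_zero]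
    rw [hzt, mul_zero, add_zero] at hM
    refine hprime.dvd_of_algebraMap_eq_mul hinj
      (mul_mem (Subalgebra.algebraMap_mem _ (L.prefixRootProd F I)) hM.2) ?_
    rw [hmul]
    linear_combination (-(algebraMap (L.S F) (L.Q F) (L.prefixRootProd F I)) *
      z.coeff (D.wordProd I)) * hinv

theorem x_root_dvd_of_sum_mem_cancellingPoles (hu : D.IsNonneg (u • D.root i))
    {I : D.weylGroup → List (Fin n)} (hI : ∀ w, D.IsReducedSeq (I w) w)
    (p : D.weylGroup → L.S F) (U : Finset D.weylGroup)
    (hU : (u • L.invX F i) •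
      ∑ w ∈ U, algebraMap (L.S F) (L.Q F) (p w) • L.demazureProd F (I w) ∈
        L.cancellingPoles F u i) :
    ∀ w ∈ U, F.x (u • L.simpleRoot i) ∣ p w := by
  classical
  -- The longest element is treated first: the other terms have length at most that of w and
  -- contribute neither at w nor at longer elements.
  induction U using Finset.induction_on_max_value D.length with
  | empty => simp
  | insert w U hw hmax ih =>
    rw [Finset.sum_insert hw] at hU
    have hdvd : F.x (u • L.simpleRoot i) ∣ p w := by
      refine L.x_root_dvd_of_smul_mem_cancellingPoles F hu (hI w) rfl (fun v hv' => ?_) hU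
      have hv : D.length w ≤ D.length v := hv'.elim (fun h0 => h0 ▸ le_rfl) le_of_lt
      rw [SkewMonoidAlgebra.coeff_finsetSum, Finsupp.finsetSum_apply]
      refine Finset.sum_eq_zero fun x hx => ?_
      rw [SkewMonoidAlgebra.coeff_smul, Finsupp.smul_apply, L.coeff_demazureProd_eq_zero F (I x)
        ((hI x).2.trans_le ((hmax x hx).trans hv)), smul_zero]
      rw [(hI x).1]
      rintro rfl
      rcases hv' with rfl | hlt
      · exact hw hx
      · exact hlt.not_ge (hmax v hx)
    refine Finset.forall_mem_insert _ _ _ |>.2 ⟨hdvd, ih ?_⟩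
    obtain ⟨d, hd⟩ := hdvd
    -- With p_w = x_α d, the leading term of x_α⁻¹ z is d X_{I_w}, which has cancelling poles and
    -- can be removed.
    rw [smul_add] at hU
    refine (AddSubgroup.add_mem_cancel_left _ ?_).1 hU
    rw [hd, map_mul, smul_smul, ← mul_assoc, mul_comm (u • L.invX F i),
      L.algebraMap_x_mul_smul_invX, one_mul]
    exact L.smul_mem_cancellingPoles F (Subalgebra.algebraMap_mem _ d)
      (L.demazureProd_mem_cancellingPoles F (I w))

end KMRootDatum.DemazureLattice

theorem proposition3p3 {R : Type*} [CommRing R] [IsDomain R] [CharZero R]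
    (F : FormalGroup R) [F.IsComm]
    {n : ℕ} {A : Matrix (Fin n) (Fin n) ℤ} {h : Type*} [AddCommGroup h] [Module ℂ h]
    (D : KMRootDatum A h) (L : D.DemazureLattice)
    (I : D.weylGroup → List (Fin n)) (hI : ∀ w, D.IsReducedSeq (I w) w)
    (k : ℕ) (p : D.weylGroup → L.S F) (z : L.QW F)
    (hz : z = ∑ w ∈ D.lengthLE k, algebraMap (L.S F) (L.Q F) (p w) • L.demazureProd F (I w))
    (α : L.carrier) (hα : (α : Module.Dual ℂ h) ∈ D.posRoots)
    (hzS : ∀ f : L.S F, ∃ g : L.S F,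
      L.act F z (algebraMap (L.S F) (L.Q F) f) = algebraMap (L.S F) (L.Q F) (F.x α * g)) :
    ∀ w ∈ D.lengthLE k, F.x α ∣ p w := by
  obtain ⟨⟨u, i, hui⟩, hpos⟩ := hα
  obtain rfl : α = u • L.simpleRoot i := Subtype.ext hui
  refine L.x_root_dvd_of_sum_mem_cancellingPoles F hpos hI p _ ?_
  rw [← hz]
  refine L.smul_invX_smul_mem_cancellingPoles F ?_ hzS
  rw [hz]
  exact sum_mem fun w _ => L.smul_mem_cancellingPoles F (Subalgebra.algebraMap_mem _ _)
    (L.demazureProd_mem_cancellingPoles F (I w))
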